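/- Setting. Base stations (BSs) form a homogeneous Poisson point process $\Phi$ of intensity $\lambda>0$ in $\mathbb{R}^2$, and the typical user is at the origin $o$. Let $M\ge 1$ be the number of beams, and for $1\le i\le M$ let $S_i$ be the set of points of $\mathbb{R}^2$ whose polar angle lies in $[2\pi\frac{i-1}{M},2\pi\frac{i}{M})$. The path loss at distance $r$ is $\ell(r)=Cr^{\alpha}$ with $C>0$, $\alpha>0$, the detection threshold is $\Gamma_{cs}>0$, and the network is interference limited, i.e. the noise power is $W=0$. In every initial access (IA) cycle $n=1,2,\dots$ the link from each BS $x\in\Phi$ to the user has an exponential fading variable $F_x(n)$ of mean one; these variables are independent over BSs and cycles and independent of $\Phi$, while $\Phi$ is the same in all cycles. Let $x_0^i$ be the BS of smallest path loss in $\Phi\cap S_i$. Sector $i$ is detected in cycle $n$ if $$\frac{F_{x_0^i}(n)/\ell(\|x_0^i\|)}{\sum_{x\in\Phi\cap S_i\setminus\{x_0^i\}}F_x(n)/\ell(\|x\|)}>\Gamma_{cs},$$ where the ratio is $0$ if the sum diverges. Cell search succeeds in cycle $n$ if at least one of the $M$ sectors is detected, and $L_{cs}(M)\in\{1,2,\dots\}\cup\{\infty\}$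 is the index of the first cycle in which it succeeds. Claim. For $j\ge 0$ put $$A_j=\sum_{k=0}^{j}\frac{(-1)^k\binom{j}{k}}{1+2\int_{1}^{\infty}\bigl(1-(1+\Gamma_{cs}/r^{\alpha})^{-k}\bigr)\,r\,dr},$$ where a term whose integral diverges is $0$. Then $A_j\ge 0$ for all $j$, and $$\mathbb{E}[L_{cs}(M)]=\sum_{j=0}^{\infty}A_j^{M}$$ as an identity in $[0,\infty]$. In particular, $\mathbb{E}[L_{cs}(M)]$ does not depend on $\lambda$. -/

import Mathlib

open MeasureTheory ProbabilityTheory Set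
open scoped ENNReal NNReal

noncomputable section

namespace CellSearch

/-! The plane `ℝ²` is identified with `ℂ` (Euclidean norm, Lebesgue measure); the typical user is
at the origin. A locally finite random configuration of base stations is given by a sequence
`x : ℕ → Ω → ℂ` of random points, and `F n j` is the fading variable of the link from the `j`-th
base station to the user during the initial access cycle `n`. -/

/-- The number of points of the configuration in `B`, counted with multiplicity. -/
def count {Ω : Type*} (x : ℕ → Ω → ℂ) (B : Set ℂ) (ω : Ω) : ℕ∞ :=
  {j : ℕ | x j ω ∈ B}.encard

/-- The random points `x` form a homogeneous Poisson point process in the plane with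
intensity `lam`. -/
structure IsPoissonPointProcess {Ω : Type*} [MeasurableSpace Ω] (μ : Measure Ω) (lam : ℝ≥0)
    (x : ℕ → Ω → ℂ) : Prop where
  measurable : ∀ j, Measurable (x j)
  poisson : ∀ B : Set ℂ, MeasurableSet B → volume B < ∞ → ∀ k : ℕ,
    μ {ω | count x B ω = k} = poissonMeasure (lam * (volume B).toNNReal) {k}
  indep : ∀ (m : ℕ) (B : Fin m → Set ℂ), (∀ i, MeasurableSet (B i)) → (∀ i, volume (B i) < ∞) →
    Pairwise (fun i i' => Disjoint (B i) (B i')) → iIndepFun (fun i => count x (B i)) μ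

/-- Poisson base stations of intensity `lam` and Rayleigh fading: the fading variables are
exponential with mean one, independent over links and cycles, and independent of the locations. -/
structure IsPoissonRayleighNetwork {Ω : Type*} [MeasurableSpace Ω] (μ : Measure Ω) (lam : ℝ≥0)
    (x : ℕ → Ω → ℂ) (F : ℕ → ℕ → Ω → ℝ) : Prop where
  ppp : IsPoissonPointProcess μ lam x
  measurable_fading : ∀ n j, Measurable (F n j)
  law_fading : ∀ n j, μ.map (F n j) = expMeasure 1
  indep_fading : iIndepFun (fun p : ℕ × ℕ => F p.1 p.2) μ
  indep_locations : IndepFun (fun ω (j : ℕ) => x j ω) (fun ω (p : ℕ × ℕ) => F p.1 p.2 ω) μ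

/-- The polar angle of `z`, normalized to `[0, 2π)`. -/
def angle (z : ℂ) : ℝ := if 0 ≤ z.arg then z.arg else z.arg + 2 * Real.pi

/-- The `M` base station sectors, numbered from `0` to `M - 1`. -/
def sector (M : ℕ) (i : Fin M) : Set ℂ :=
  {z | angle z ∈ Ico (2 * Real.pi * (i : ℕ) / M) (2 * Real.pi * ((i : ℕ) + 1) / M)}

/-- The single-slope path loss function. -/
def pathLoss (C α : ℝ) (r : ℝ) : ℝ := C * r ^ α

/-- Received power (up to the common factor `P * M`), for path loss function `l`, from a base
station at `z` with fading `f`. -/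
def rxPower (l : ℝ → ℝ) (z : ℂ) (f : ℝ) : ℝ≥0∞ := ENNReal.ofReal f / ENNReal.ofReal (l ‖z‖)

/-- The total power of the base stations other than `k` in sector `i`, for the locations `y` and
fading variables `f`; it is `∞` when the series diverges. -/
def interference (l : ℝ → ℝ) (M : ℕ) (i : Fin M) (y : ℕ → ℂ) (f : ℕ → ℝ) (k : ℕ) : ℝ≥0∞ :=
  ∑' j : {j : ℕ // y j ∈ sector M i ∧ j ≠ k}, rxPower l (y j) (f j)

/-- The signal-to-interference-plus-noise ratio of base station `k` in sector `i`, with noise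
power `W` and transmit power `P`. -/
def sinr (l : ℝ → ℝ) (W P : ℝ) (M : ℕ) (i : Fin M) (y : ℕ → ℂ) (f : ℕ → ℝ) (k : ℕ) : ℝ≥0∞ :=
  rxPower l (y k) (f k) / (interference l M i y f k + ENNReal.ofReal (W / (P * M)))

/-- Sector `i` is detected: the base station of smallest path loss inside the sector has an SINR
above the threshold `Γ`. -/
def SectorDetected (l : ℝ → ℝ) (W P Γ : ℝ) (M : ℕ) (i : Fin M) (y : ℕ → ℂ) (f : ℕ → ℝ) : Prop :=
  ∃ k : ℕ, y k ∈ sector M i ∧ (∀ j, y j ∈ sector M i → l ‖y k‖ ≤ l ‖y j‖) ∧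
    ENNReal.ofReal Γ < sinr l W P M i y f k

/-- Cell search succeeds in a cycle if at least one sector is detected. -/
def Success (l : ℝ → ℝ) (W P Γ : ℝ) (M : ℕ) (y : ℕ → ℂ) (f : ℕ → ℝ) : Prop :=
  ∃ i : Fin M, SectorDetected l W P Γ M i y f

/-- The number of initial access cycles up to the first success (`⊤` if there is none). -/
def numCycles {Ω : Type*} (l : ℝ → ℝ) (W P Γ : ℝ) (M : ℕ) (x : ℕ → Ω → ℂ) (F : ℕ → ℕ → Ω → ℝ)
    (ω : Ω) : ℕ∞ :=
  ⨅ n ∈ {n : ℕ | 1 ≤ n ∧ Success l W P Γ M (fun j => x j ω) (fun j => F n j ω)}, (n : ℕ∞)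

/-- The mean number of initial access cycles, in `[0, ∞]`. -/
def meanCycles {Ω : Type*} [MeasurableSpace Ω] (μ : Measure Ω) (l : ℝ → ℝ) (W P Γ : ℝ) (M : ℕ)
    (x : ℕ → Ω → ℂ) (F : ℕ → ℕ → Ω → ℝ) : ℝ≥0∞ :=
  ∫⁻ ω, (numCycles l W P Γ M x F ω : ℝ≥0∞) ∂μ

/-- `∫₁^∞ (1 - (1 + Γ / r ^ α)⁻ᵏ) r dr`, an integral of a nonnegative function, in `[0, ∞]`. -/
def tailIntegral (Γ α : ℝ) (k : ℕ) : ℝ≥0∞ :=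
  ∫⁻ r in Ioi (1 : ℝ), ENNReal.ofReal ((1 - (1 + Γ / r ^ α) ^ (-(k : ℤ))) * r)

/-- The alternating sum `∑ₖ (-1)ᵏ (j choose k) / (1 + 2 ∫₁^∞ (1 - (1 + Γ / r ^ α)⁻ᵏ) r dr)`, a term
with a divergent integral being `0`. -/
def coeffA (Γ α : ℝ) (j : ℕ) : ℝ :=
  ∑ k ∈ Finset.range (j + 1),
    (-1 : ℝ) ^ k * (j.choose k : ℝ) * (1 / (1 + 2 * tailIntegral Γ α k)).toReal

end CellSearch

end

/-! Fix the base stations. Failures in successive cycles are then independent with a common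
probability `q`, so the mean of `L = ∑ₙ 1{n < L}` is `∑ₙ E[qⁿ]` (`measure_lt_numCycles`). The
sectors use disjoint sets of links, hence `q = ∏ᵢ (1 - pᵢ)`, and the Laplace transform of the
exponential law gives `pᵢ = ∏ (1 + Γ (r₀ / r) ^ α)⁻¹` over the interferers of sector `i`
(`measure_not_success`).

Now average over the Poisson process. Sectors are independent, so `E[qⁿ]` is the `M`-th power of
`E[(1 - p)ⁿ] = ∑ₖ (-1)ᵏ (n choose k) E[pᵏ]`. With `c = λπ / M`, the values `c r²` in one sector form
a Poisson process of rate one on `(0, ∞)`, which removes `λ`. The smallest value `t` is exponential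
of mean one; given `t`, scaling yields `E[pᵏ | t] = exp (-2 t Tₖ)`, where `Tₖ` is the tail integral
(`setLIntegral_logLoss`). Integration over `t` gives `1 / (1 + 2 Tₖ)`, so that `E[(1 - p)ⁿ] = Aₙ`.

Conditioning on the nearest point is replaced by a dyadic discretization of `t`. The event `t ≥ a`
is itself exponential in an additive functional, with weight `∞` on the points below `a`; hence
every discretized term is an `expNeg (∑ h (xⱼ))`, to which the Laplace functional
`integral_expNeg_tsum` applies. Dominated convergence removes the discretization
(`integral_prod_pow`).

Nonnegativity of `Aⱼ` is proved without any network: `k ↦ 1 / (1 + 2 Tₖ)` is completely monotone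
when the `Tₖ` are finite, since the increments of `Tₖ` are. -/

namespace CellSearch

/-! ### The function `e⁻ᵃ` on `[0, ∞]` -/

open Filter Topology

/-- The function `a ↦ e⁻ᵃ` on `[0, ∞]`, with value `0` at `∞`. -/
noncomputable def expNeg (a : ℝ≥0∞) : ℝ := (EReal.exp (-(a : EReal))).toReal

lemma expNeg_of_ne_top {a : ℝ≥0∞} (ha : a ≠ ∞) : expNeg a = Real.exp (-a.toReal) := by
  lift a to ℝ≥0 using ha
  have : (-((a : ℝ≥0∞) : EReal)) = ((-(a : ℝ) : ℝ) : EReal) := rfl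
  rw [expNeg, this, EReal.exp_coe, ENNReal.toReal_ofReal (Real.exp_nonneg _)]
  simp

lemma expNeg_ofReal {x : ℝ} (hx : 0 ≤ x) : expNeg (ENNReal.ofReal x) = Real.exp (-x) := by
  rw [expNeg_of_ne_top ENNReal.ofReal_ne_top, ENNReal.toReal_ofReal hx]

@[simp] lemma expNeg_top : expNeg ∞ = 0 := by simp [expNeg]

@[simp] lemma expNeg_zero : expNeg 0 = 1 := by simp [expNeg]

lemma expNeg_nonneg (a : ℝ≥0∞) : 0 ≤ expNeg a := ENNReal.toReal_nonneg

lemma expNeg_antitone : Antitone expNeg := by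
  intro a b hab
  refine ENNReal.toReal_mono ?_ (EReal.exp_monotone (EReal.neg_le_neg_iff.2 ?_))
  · simp [EReal.neg_eq_top_iff]
  · exact_mod_cast hab

lemma expNeg_le_one (a : ℝ≥0∞) : expNeg a ≤ 1 := by
  simpa using expNeg_antitone (zero_le : 0 ≤ a)

lemma norm_expNeg_le (a : ℝ≥0∞) : ‖expNeg a‖ ≤ 1 := by
  rw [Real.norm_of_nonneg (expNeg_nonneg a)]
  exact expNeg_le_one a

lemma continuous_expNeg : Continuous expNeg := by
  rw [continuous_iff_continuousAt]
  intro a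
  have h1 : Continuous fun a : ℝ≥0∞ ↦ EReal.exp (-(a : EReal)) :=
    EReal.expHomeomorph.continuous.comp (continuous_neg.comp continuous_coe_ennreal_ereal)
  refine (ENNReal.continuousAt_toReal ?_).comp h1.continuousAt
  simp [EReal.neg_eq_top_iff]

@[fun_prop] lemma measurable_expNeg : Measurable expNeg := continuous_expNeg.measurable

lemma expNeg_add (a b : ℝ≥0∞) : expNeg (a + b) = expNeg a * expNeg b := by
  by_cases ha : a = ∞
  · simp [ha]
  by_cases hb : b = ∞
  · simp [hb]
  rw [expNeg_of_ne_top ha, expNeg_of_ne_top hb, expNeg_of_ne_top (ENNReal.add_ne_top.2 ⟨ha, hb⟩),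
    ENNReal.toReal_add ha hb, ← Real.exp_add]
  ring_nf

lemma expNeg_sum {ι : Type*} (s : Finset ι) (f : ι → ℝ≥0∞) :
    expNeg (∑ i ∈ s, f i) = ∏ i ∈ s, expNeg (f i) := by
  classical
  induction s using Finset.induction_on with
  | empty => simp
  | insert i s hi ih => rw [Finset.sum_insert hi, Finset.prod_insert hi, expNeg_add, ih]

lemma expNeg_nat_mul (n : ℕ) (a : ℝ≥0∞) : expNeg (n * a) = expNeg a ^ n := by
  have := expNeg_sum (Finset.range n) (fun _ ↦ a)
  simpa using this

lemma expNeg_ofReal_log {x : ℝ} (hx : 1 ≤ x) : expNeg (ENNReal.ofReal (Real.log x)) = x⁻¹ := by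
  rw [expNeg_ofReal (Real.log_nonneg hx), Real.exp_neg, Real.exp_log (by linarith)]

/-! ### Completely monotone sequences -/

/-- All alternating differences of the sequence `f` up to order `m` are nonnegative. -/
def AlternatingDiff : ℕ → (ℕ → ℝ) → Prop
  | 0, f => ∀ k, 0 ≤ f k
  | m + 1, f => (∀ k, 0 ≤ f k) ∧ AlternatingDiff m fun k ↦ f k - f (k + 1)

namespace AlternatingDiff

lemma of_succ {m : ℕ} {f : ℕ → ℝ} (h : AlternatingDiff (m + 1) f) : AlternatingDiff m f := by
  induction m generalizing f with
  | zero => exact h.1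
  | succ m ih => exact ⟨h.1, ih h.2⟩

lemma add {m : ℕ} {f g : ℕ → ℝ} (hf : AlternatingDiff m f) (hg : AlternatingDiff m g) :
    AlternatingDiff m fun k ↦ f k + g k := by
  induction m generalizing f g with
  | zero => exact fun k ↦ add_nonneg (hf k) (hg k)
  | succ m ih =>
    refine ⟨fun k ↦ add_nonneg (hf.1 k) (hg.1 k), ?_⟩
    convert ih hf.2 hg.2 using 2
    ring

lemma shift {m : ℕ} {f : ℕ → ℝ} (hf : AlternatingDiff m f) :
    AlternatingDiff m fun k ↦ f (k + 1) := by
  induction m generalizing f with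
  | zero => exact fun k ↦ hf _
  | succ m ih => exact ⟨fun k ↦ hf.1 _, ih hf.2⟩

lemma mul {m : ℕ} {f g : ℕ → ℝ} (hf : AlternatingDiff m f) (hg : AlternatingDiff m g) :
    AlternatingDiff m fun k ↦ f k * g k := by
  induction m generalizing f g with
  | zero => exact fun k ↦ mul_nonneg (hf k) (hg k)
  | succ m ih =>
    refine ⟨fun k ↦ mul_nonneg (hf.1 k) (hg.1 k), ?_⟩
    -- Discrete Leibniz rule: `f k g k - f (k+1) g (k+1) = (f k - f (k+1)) g k + f (k+1) (g k - g
    -- (k+1))`.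
    convert (ih hf.2 hg.of_succ).add (ih hf.shift.of_succ hg.2) using 2
    ring

/-- The sum is `(-1)ᵐ` times the `m`-th forward difference of `f` at `k`. -/
lemma sum_nonneg {m : ℕ} {f : ℕ → ℝ} (hf : AlternatingDiff m f) (k : ℕ) :
    0 ≤ ∑ i ∈ Finset.range (m + 1), (-1 : ℝ) ^ i * (m.choose i : ℝ) * f (k + i) := by
  have key : ∀ (m : ℕ) (f : ℕ → ℝ), AlternatingDiff m f →
      ∀ k, 0 ≤ (-1) ^ m * (fwdDiff 1)^[m] f k := by
    intro m
    induction m with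
    | zero => intro f hf k; simpa using hf k
    | succ m ih =>
      intro f hf k
      have h := ih _ hf.2 k
      have e : (fun k ↦ f k - f (k + 1)) = (-1 : ℝ) • fwdDiff 1 f := by
        ext k; simp [fwdDiff]
      rw [e, fwdDiff_iter_const_smul] at h
      rw [Function.iterate_succ_apply, pow_succ]
      simpa using h
  have h := key m f hf k
  rw [fwdDiff_iter_eq_sum_shift, Finset.mul_sum] at h
  refine h.trans_eq (Finset.sum_congr rfl fun i hi ↦ ?_)
  have hi' : i ≤ m := Nat.lt_succ_iff.1 (Finset.mem_range.1 hi)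
  obtain ⟨d, rfl⟩ := Nat.exists_eq_add_of_le hi'
  have : ((-1 : ℝ)) ^ (i + d) * (-1) ^ d = (-1) ^ i := by
    rw [pow_add, mul_assoc, ← mul_pow]; simp
  rw [← this]
  simp
  ring

/-- If `ψ` vanishes at `0` and has completely monotone increments, then `1 / (1 + ψ)` is
completely monotone. -/
lemma one_div_one_add {ψ : ℕ → ℝ} (h0 : ∀ k, 0 ≤ ψ k)
    (hψ : ∀ m, AlternatingDiff m fun k ↦ ψ (k + 1) - ψ k) (m : ℕ) :
    AlternatingDiff m fun k ↦ 1 / (1 + ψ k) := by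
  have pos : ∀ k, 0 < 1 + ψ k := fun k ↦ by linarith [h0 k]
  induction m with
  | zero => exact fun k ↦ (one_div_pos.2 (pos k)).le
  | succ m ih =>
    refine ⟨fun k ↦ (one_div_pos.2 (pos k)).le, ?_⟩
    -- With `a k = 1 / (1 + ψ k)`, one has `a k - a (k+1) = a k * a (k+1) * (ψ (k+1) - ψ k)`, a
    -- product of sequences already known to be alternating to order `m`.
    convert (ih.mul ih.shift).mul (hψ m) using 2 with k
    field_simp [(pos k).ne', (pos (k + 1)).ne']
    ring

end AlternatingDiff

/-! ### Nonnegativity of the coefficients -/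

lemma one_add_div_rpow_pos {Γ α r : ℝ} (hΓ : 0 < Γ) (hr : 0 ≤ r) : 0 < 1 + Γ / r ^ α := by
  have := Real.rpow_nonneg hr α
  positivity

lemma one_le_one_add_div_rpow {Γ α r : ℝ} (hΓ : 0 < Γ) (hr : 0 ≤ r) : 1 ≤ 1 + Γ / r ^ α := by
  have := Real.rpow_nonneg hr α
  have : 0 ≤ Γ / r ^ α := by positivity
  linarith

lemma tailIntegral_zero (Γ α : ℝ) : tailIntegral Γ α 0 = 0 := by simp [tailIntegral]

lemma tailIntegral_eq (Γ α : ℝ) (k : ℕ) :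
    tailIntegral Γ α k = ∫⁻ r in Ioi (1 : ℝ), ENNReal.ofReal ((1 - (1 + Γ / r ^ α)⁻¹ ^ k) * r) := by
  simp [tailIntegral]

lemma tailIntegral_mono {Γ α : ℝ} (hΓ : 0 < Γ) : Monotone (tailIntegral Γ α) := by
  intro k l hkl
  simp only [tailIntegral_eq]
  refine setLIntegral_mono' measurableSet_Ioi fun r hr ↦ ENNReal.ofReal_le_ofReal ?_
  have hr0 : (0 : ℝ) ≤ r := by linarith [mem_Ioi.1 hr]
  exact mul_le_mul_of_nonneg_right (sub_le_sub_left (pow_le_pow_of_le_one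
    (inv_nonneg.2 (one_add_div_rpow_pos hΓ hr0).le)
    (inv_le_one_of_one_le₀ (one_le_one_add_div_rpow hΓ hr0)) hkl) _) hr0

/-- The increments are moments `2 ∫ uᵏ (1 - u) r dr` with `u = (1 + Γ / r ^ α)⁻¹` in `[0, 1]`.
Finiteness for all `k` follows from `k = 1` by Bernoulli's inequality `1 - uᵏ ≤ k (1 - u)`. -/
lemma alternatingDiff_tailIntegral {Γ α : ℝ} (hΓ : 0 < Γ) (h1 : tailIntegral Γ α 1 ≠ ∞) :
    (∀ k, tailIntegral Γ α k ≠ ∞) ∧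
    ∀ m, AlternatingDiff m
      fun k ↦ 2 * (tailIntegral Γ α (k + 1)).toReal - 2 * (tailIntegral Γ α k).toReal := by
  set u : ℝ → ℝ := fun r ↦ (1 + Γ / r ^ α)⁻¹ with hu
  have um : Measurable u := by fun_prop
  have u0 : ∀ r ∈ Ioi (1 : ℝ), 0 ≤ u r := fun r hr ↦
    inv_nonneg.2 (one_add_div_rpow_pos hΓ (by linarith [mem_Ioi.1 hr])).le
  have u1 : ∀ r ∈ Ioi (1 : ℝ), u r ≤ 1 := fun r hr ↦
    inv_le_one_of_one_le₀ (one_le_one_add_div_rpow hΓ (by linarith [mem_Ioi.1 hr]))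
  have base : IntegrableOn (fun r ↦ (1 - u r) * r) (Ioi 1) := by
    refine ⟨by fun_prop, ?_⟩
    rw [hasFiniteIntegral_iff_ofReal]
    · rw [tailIntegral_eq] at h1
      simpa [hu, lt_top_iff_ne_top] using h1
    · filter_upwards [ae_restrict_mem measurableSet_Ioi] with r hr
      have := u1 r hr
      have h2 := mem_Ioi.1 hr
      exact mul_nonneg (by linarith) (by linarith)
  have gi : ∀ k n, IntegrableOn (fun r ↦ u r ^ k * (1 - u r) ^ (n + 1) * r) (Ioi 1) := by
    intro k n
    refine base.mono' (by fun_prop) ?_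
    filter_upwards [ae_restrict_mem measurableSet_Ioi] with r hr
    have h0 := u0 r hr
    have h1 := u1 r hr
    have h2 := mem_Ioi.1 hr
    have h3 : 0 ≤ 1 - u r := by linarith
    rw [Real.norm_of_nonneg (by positivity)]
    gcongr
    rw [pow_succ, ← mul_assoc]
    exact mul_le_of_le_one_left h3
      (mul_le_one₀ (pow_le_one₀ h0 h1) (by positivity) (pow_le_one₀ h3 (by linarith)))
  have ti : ∀ k, IntegrableOn (fun r ↦ (1 - u r ^ k) * r) (Ioi 1) := by
    intro k
    refine (base.const_mul (k : ℝ)).mono' (by fun_prop) ?_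
    filter_upwards [ae_restrict_mem measurableSet_Ioi] with r hr
    have h0 := u0 r hr
    have h1 := u1 r hr
    have h2 := mem_Ioi.1 hr
    have h3 : 0 ≤ 1 - u r ^ k := by linarith [pow_le_one₀ h0 h1 (n := k)]
    rw [Real.norm_of_nonneg (by positivity), ← mul_assoc]
    gcongr
    have := one_add_mul_le_pow (a := u r - 1) (by linarith) k
    rw [add_sub_cancel] at this
    linarith
  have tr : ∀ k, (tailIntegral Γ α k).toReal = ∫ r in Ioi (1 : ℝ), (1 - u r ^ k) * r := by
    intro k
    rw [tailIntegral_eq, integral_eq_lintegral_of_nonneg_ae _ (by fun_prop)]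
    filter_upwards [ae_restrict_mem measurableSet_Ioi] with r hr
    have h0 := u0 r hr
    have h1 := u1 r hr
    have h2 := mem_Ioi.1 hr
    have h3 : 0 ≤ 1 - u r ^ k := by linarith [pow_le_one₀ h0 h1 (n := k)]
    exact mul_nonneg h3 (by linarith)
  refine ⟨fun k ↦ ?_, fun m ↦ ?_⟩
  · rw [tailIntegral_eq]
    exact (ti k).lintegral_lt_top.ne
  -- Differencing in `k` raises the exponent of `1 - u` by one, so the induction on `m` runs over
  -- all `n` at once.
  have cm : ∀ m n, AlternatingDiff m
      fun k ↦ 2 * ∫ r in Ioi (1 : ℝ), u r ^ k * (1 - u r) ^ (n + 1) * r := by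
    have nn : ∀ n k, 0 ≤ 2 * ∫ r in Ioi (1 : ℝ), u r ^ k * (1 - u r) ^ (n + 1) * r := by
      intro n k
      refine mul_nonneg zero_le_two (setIntegral_nonneg measurableSet_Ioi fun r hr ↦ ?_)
      have h0 := u0 r hr
      have h1 := u1 r hr
      have h2 := mem_Ioi.1 hr
      have h3 : 0 ≤ 1 - u r := by linarith
      positivity
    intro m
    induction m with
    | zero => exact nn
    | succ m ih =>
      intro n
      refine ⟨nn n, ?_⟩
      convert ih (n + 1) using 2 with k
      rw [← mul_sub, ← integral_sub (gi k n) (gi (k + 1) n)]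
      congr 2
      ext r
      ring
  convert cm m 0 using 2 with k
  rw [tr, tr, ← mul_sub, ← integral_sub (ti _) (ti _)]
  congr 2
  ext r
  ring

/-- The `k`-th moment of the detection probability of a sector. -/
noncomputable def moment (Γ α : ℝ) (k : ℕ) : ℝ := (1 / (1 + 2 * tailIntegral Γ α k)).toReal

lemma coeffA_nonneg {Γ α : ℝ} (hΓ : 0 < Γ) (j : ℕ) : 0 ≤ coeffA Γ α j := by
  by_cases h1 : tailIntegral Γ α 1 = ∞
  -- If the integral diverges for `k = 1` it does so for all `k ≥ 1`; only the term `k = 0` survives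
  -- and the coefficient is `1`.
  · have h : ∀ k ∈ Finset.range (j + 1), k ≠ 0 → (-1 : ℝ) ^ k * (j.choose k : ℝ) *
        (1 / (1 + 2 * tailIntegral Γ α k)).toReal = 0 := by
      intro k _ hk
      have : tailIntegral Γ α k = ∞ := top_le_iff.1
        (h1 ▸ tailIntegral_mono hΓ (Nat.one_le_iff_ne_zero.2 hk))
      simp [this]
    rw [coeffA, Finset.sum_eq_single_of_mem 0 (by simp) h]
    simp [tailIntegral_zero]
  · obtain ⟨hf, hcm⟩ := alternatingDiff_tailIntegral hΓ h1
    have := (AlternatingDiff.one_div_one_add (ψ := fun k ↦ 2 * (tailIntegral Γ α k).toReal)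
      (fun k ↦ by positivity) hcm j).sum_nonneg 0
    refine this.trans_eq (Finset.sum_congr rfl fun k _ ↦ ?_)
    rw [zero_add, ENNReal.toReal_div, ENNReal.toReal_add (by simp)
      (ENNReal.mul_ne_top (by simp) (hf k))]
    simp

/-! ### The Laplace functional of a Poisson process -/

lemma tsum_indicator_const {Ω : Type*} (x : ℕ → Ω → ℂ) (B : Set ℂ) (c : ℝ≥0∞) (ω : Ω) :
    ∑' j, B.indicator (fun _ ↦ c) (x j ω) = (count x B ω : ℝ≥0∞) * c := by
  rw [count, ← ENNReal.tsum_set_const, tsum_subtype {j | x j ω ∈ B} fun _ ↦ c]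
  rfl

section LaplaceFunctional

variable {Ω : Type*} [MeasurableSpace Ω] {μ : Measure Ω} {lam : ℝ≥0} {x : ℕ → Ω → ℂ}

lemma measurable_count (hx : ∀ j, Measurable (x j)) {B : Set ℂ} (hB : MeasurableSet B) :
    Measurable (count x B) := by
  rw [ENat.measurable_iff]
  intro n
  have h : Measurable fun ω ↦ ∑' j, B.indicator (fun _ ↦ (1 : ℝ≥0∞)) (x j ω) :=
    Measurable.tsum fun j ↦ (measurable_const.indicator hB).comp (hx j)
  simp only [tsum_indicator_const, mul_one] at h
  convert h (measurableSet_singleton (n : ℝ≥0∞)) using 1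
  ext ω
  simp only [mem_preimage, mem_singleton_iff]
  rw [← ENat.toENNReal_coe, ENat.toENNReal_inj]

lemma tendsto_tsum_of_monotone {f : ℕ → ℕ → ℝ≥0∞} {g : ℕ → ℝ≥0∞}
    (hf : ∀ j, Monotone fun n ↦ f n j) (hg : ∀ j, Tendsto (fun n ↦ f n j) atTop (𝓝 (g j))) :
    Tendsto (fun n ↦ ∑' j, f n j) atTop (𝓝 (∑' j, g j)) := by
  simp_rw [← lintegral_count]
  exact lintegral_tendsto_of_tendsto_of_monotone (fun n ↦ measurable_from_top.aemeasurable)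
    (Eventually.of_forall hf) (Eventually.of_forall hg)

namespace IsPoissonPointProcess

/-- Local finiteness is not part of the definition; it holds because the Poisson weights of the
finite values already sum to one. -/
lemma ae_count_ne_top [IsProbabilityMeasure μ] (h : IsPoissonPointProcess μ lam x) {B : Set ℂ}
    (hB : MeasurableSet B) (hB' : volume B < ∞) : ∀ᵐ ω ∂μ, count x B ω ≠ ⊤ := by
  have hm := measurable_count h.measurable hB
  have e : {ω | count x B ω ≠ ⊤} = ⋃ k : ℕ, {ω | count x B ω = k} := by
    ext ω
    simp [ENat.ne_top_iff_exists, eq_comm]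
  have hmk : ∀ k : ℕ, MeasurableSet {ω | count x B ω = k} := fun k ↦
    hm (measurableSet_singleton _)
  have : μ {ω | count x B ω ≠ ⊤} = 1 := by
    rw [e, measure_iUnion _ hmk]
    · simp_rw [h.poisson B hB hB']
      have := Measure.tsum_indicator_apply_singleton (poissonMeasure (lam * (volume B).toNNReal)) univ .univ
      simpa using this
    · intro i j hij
      refine Set.disjoint_left.2 fun ω hi hj ↦ hij ?_
      simp only [mem_ofPred_eq] at hi hj
      exact_mod_cast hi.symm.trans hj
  rw [ae_iff, ← prob_compl_eq_one_iff]
  · convert this using 2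
    ext; simp
  · have := hm (measurableSet_singleton ⊤)
    rw [show {ω | ¬count x B ω ≠ ⊤} = count x B ⁻¹' {⊤} by ext; simp]
    exact this

/-- This is the Poisson generating function at `e⁻ᶜ`. The value `c = ∞` is allowed and yields the
void probability. -/
lemma integral_expNeg_count [IsProbabilityMeasure μ] (h : IsPoissonPointProcess μ lam x)
    {B : Set ℂ} (hB : MeasurableSet B) (hB' : volume B < ∞) (c : ℝ≥0∞) :
    ∫ ω, expNeg (count x B ω * c) ∂μ =
      expNeg (lam * (volume B * ENNReal.ofReal (1 - expNeg c))) := by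
  have hm := measurable_count h.measurable hB
  set r : ℝ≥0 := lam * (volume B).toNNReal with hr
  have hfin := h.ae_count_ne_top hB hB'
  have hN : Measurable fun ω ↦ (count x B ω).toNat := Measurable.comp (by fun_prop) hm
  have hmap : μ.map (fun ω ↦ (count x B ω).toNat) = poissonMeasure r := by
    refine Measure.ext_of_singleton fun k ↦ ?_
    rw [Measure.map_apply hN (measurableSet_singleton k), ← h.poisson B hB hB' k]
    refine measure_congr ?_
    filter_upwards [hfin] with ω hω
    refine propext ?_
    change (count x B ω).toNat = k ↔ count x B ω = k
    lift count x B ω to ℕ using hω with n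
    simp
  -- For `c = ∞` and no points both sides equal `1`, by `0 * ∞ = 0` and `0 ^ 0 = 1`.
  have h1 : ∫ ω, expNeg (count x B ω * c) ∂μ = ∫ ω, expNeg c ^ (count x B ω).toNat ∂μ := by
    refine integral_congr_ae ?_
    filter_upwards [hfin] with ω hω
    lift count x B ω to ℕ using hω with n
    simp [expNeg_nat_mul]
  have h2 : ∫ ω, expNeg c ^ (count x B ω).toNat ∂μ = ∫ n, expNeg c ^ n ∂poissonMeasure r := by
    rw [← hmap, integral_map hN.aemeasurable (by fun_prop)]
  rw [h1, h2, integral_poissonMeasure]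
  have h3 : ∑' n : ℕ, (Real.exp (-(r : ℝ)) * (r : ℝ) ^ n / (n.factorial : ℝ)) • expNeg c ^ n =
      Real.exp (-(r : ℝ)) * Real.exp (r * expNeg c) := by
    rw [show Real.exp (r * expNeg c) = NormedSpace.exp (r * expNeg c) by rw [Real.exp_eq_exp_ℝ],
      NormedSpace.exp_eq_tsum_div, ← tsum_mul_left]
    refine tsum_congr fun n ↦ ?_
    rw [smul_eq_mul, mul_pow]
    ring
  rw [h3, ← Real.exp_add]
  have hc : 0 ≤ 1 - expNeg c := by linarith [expNeg_le_one c]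
  have : (lam : ℝ≥0∞) * (volume B * ENNReal.ofReal (1 - expNeg c)) =
      ENNReal.ofReal (r * (1 - expNeg c)) := by
    rw [ENNReal.ofReal_mul (by positivity), ← mul_assoc, hr, ENNReal.ofReal_coe_nnreal,
      ENNReal.coe_mul, ENNReal.coe_toNNReal hB'.ne]
  rw [this, expNeg_ofReal (by positivity)]
  ring_nf

lemma iIndepFun_count (h : IsPoissonPointProcess μ lam x) {ι : Type*} [Fintype ι] {B : ι → Set ℂ}
    (hB : ∀ i, MeasurableSet (B i)) (hB' : ∀ i, volume (B i) < ∞)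
    (hd : Pairwise fun i i' ↦ Disjoint (B i) (B i')) : iIndepFun (fun i ↦ count x (B i)) μ := by
  let e := Fintype.equivFin ι
  have := h.indep (Fintype.card ι) (fun k ↦ B (e.symm k)) (fun k ↦ hB _) (fun k ↦ hB' _)
    (fun i j hij ↦ hd (e.symm.injective.ne hij))
  simpa using this.precomp e.injective

lemma integral_expNeg_sum_count [IsProbabilityMeasure μ] (h : IsPoissonPointProcess μ lam x)
    {ι : Type*} [Fintype ι] {B : ι → Set ℂ} (hB : ∀ i, MeasurableSet (B i))
    (hB' : ∀ i, volume (B i) < ∞) (hd : Pairwise fun i i' ↦ Disjoint (B i) (B i'))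
    (c : ι → ℝ≥0∞) :
    ∫ ω, expNeg (∑ i, count x (B i) ω * c i) ∂μ =
      expNeg (lam * ∑ i, volume (B i) * ENNReal.ofReal (1 - expNeg (c i))) := by
  simp_rw [Finset.mul_sum, expNeg_sum]
  rw [(h.iIndepFun_count hB hB' hd).integral_fun_prod_comp (𝓧 := fun _ ↦ ℕ∞)
    (f := fun i (n : ℕ∞) ↦ expNeg ((n : ℝ≥0∞) * c i))]
  · exact Finset.prod_congr rfl fun i _ ↦ h.integral_expNeg_count (hB i) (hB' i) (c i)
  · exact fun i ↦ (measurable_count h.measurable (hB i)).aemeasurable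
  · intro i
    exact (Measurable.comp (by fun_prop) (by fun_prop) : Measurable
      fun n : ℕ∞ ↦ expNeg ((n : ℝ≥0∞) * c i)).aestronglyMeasurable

/-- The Laplace functional of a Poisson point process. -/
theorem integral_expNeg_tsum [IsProbabilityMeasure μ] (hx : IsPoissonPointProcess μ lam x)
    {h : ℂ → ℝ≥0∞} (hh : Measurable h) :
    ∫ ω, expNeg (∑' j, h (x j ω)) ∂μ =
      expNeg (lam * ∫⁻ z, ENNReal.ofReal (1 - expNeg (h z))) := by
  -- Simple functions cut off to growing balls increase to `h`; the cut-off gives the level sets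
  -- finite volume, so that the finite-dimensional formula applies.
  let f := SimpleFunc.eapprox h
  let R : ℕ → Set ℂ := fun n ↦ Metric.closedBall 0 n
  let g : ℕ → ℂ → ℝ≥0∞ := fun n ↦ (R n).indicator (f n)
  have hR : ∀ n, MeasurableSet (R n) := fun n ↦ Metric.isClosed_closedBall.measurableSet
  have gm : ∀ n, Measurable (g n) := fun n ↦ (f n).measurable.indicator (hR n)
  have gmono : ∀ z, Monotone fun n ↦ g n z := by
    intro z n m hnm
    refine (indicator_le_indicator (SimpleFunc.monotone_eapprox h hnm z)).trans
      (indicator_le_indicator_of_subset (Metric.closedBall_subset_closedBall ?_)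
        (fun _ ↦ zero_le) _)
    exact_mod_cast hnm
  have gtend : ∀ z, Tendsto (fun n ↦ g n z) atTop (𝓝 (h z)) := by
    intro z
    refine (SimpleFunc.tendsto_eapprox hh z).congr' ?_
    filter_upwards [eventually_ge_atTop ⌈‖z‖⌉₊] with n hn
    have : z ∈ R n := by simpa [R] using Nat.ceil_le.1 hn
    simp [g, f, this]
  have step : ∀ n, ∫ ω, expNeg (∑' j, g n (x j ω)) ∂μ =
      expNeg (lam * ∫⁻ z, ENNReal.ofReal (1 - expNeg (g n z))) := by
    intro n
    let B : (f n).range → Set ℂ := fun r ↦ f n ⁻¹' {r.1} ∩ R n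
    have hB : ∀ r, MeasurableSet (B r) := fun r ↦ ((f n).measurableSet_fiber r.1).inter (hR n)
    have hB' : ∀ r, volume (B r) < ∞ := fun r ↦
      (measure_mono inter_subset_right).trans_lt measure_closedBall_lt_top
    have hd : Pairwise fun i i' ↦ Disjoint (B i) (B i') := by
      intro i j hij
      refine Set.disjoint_left.2 fun z hi hj ↦ hij (Subtype.ext ?_)
      exact hi.1.symm.trans hj.1
    have key : ∀ (F : ℝ≥0∞ → ℝ≥0∞), F 0 = 0 → ∀ z,
        F (g n z) = ∑ r, (B r).indicator (fun _ ↦ F r.1) z := by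
      intro F hF z
      by_cases hz : z ∈ R n
      · rw [Finset.sum_eq_single (⟨f n z, SimpleFunc.mem_range_self _ z⟩ : (f n).range)]
        · have hz' : z ∈ B ⟨f n z, SimpleFunc.mem_range_self _ z⟩ := ⟨rfl, hz⟩
          rw [indicator_of_mem hz']
          simp [g, hz]
        · intro r _ hr
          refine indicator_of_notMem (fun hzr ↦ hr (Subtype.ext ?_)) _
          exact hzr.1.symm
        · simp
      · rw [Finset.sum_eq_zero fun r _ ↦ indicator_of_notMem (fun h ↦ hz h.2) _]
        simp [g, hz, hF]
    have e1 : ∀ ω, ∑' j, g n (x j ω) = ∑ r, count x (B r) ω * r.1 := by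
      intro ω
      rw [tsum_congr fun j ↦ key (fun a ↦ a) rfl (x j ω)]
      rw [Summable.tsum_finsetSum fun _ _ ↦ ENNReal.summable]
      simp_rw [tsum_indicator_const]
    have e2 : ∫⁻ z, ENNReal.ofReal (1 - expNeg (g n z)) =
        ∑ r, volume (B r) * ENNReal.ofReal (1 - expNeg r.1) := by
      simp_rw [key (fun a ↦ ENNReal.ofReal (1 - expNeg a)) (by simp)]
      rw [lintegral_finsetSum _ fun r _ ↦ measurable_const.indicator (hB r)]
      refine Finset.sum_congr rfl fun r _ ↦ ?_
      rw [lintegral_indicator_const (hB r), mul_comm]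
    simp_rw [e1]
    rw [e2, hx.integral_expNeg_sum_count hB hB' hd]
  have lhs : Tendsto (fun n ↦ ∫ ω, expNeg (∑' j, g n (x j ω)) ∂μ) atTop
      (𝓝 (∫ ω, expNeg (∑' j, h (x j ω)) ∂μ)) := by
    refine tendsto_integral_of_dominated_convergence (fun _ ↦ 1) (fun n ↦ ?_)
      (integrable_const _) (fun n ↦ Eventually.of_forall fun ω ↦ norm_expNeg_le _)
      (Eventually.of_forall fun ω ↦ ?_)
    · exact (measurable_expNeg.comp (Measurable.tsum fun j ↦
        (gm n).comp (hx.measurable j))).aestronglyMeasurable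
    · exact (continuous_expNeg.tendsto _).comp
        (tendsto_tsum_of_monotone (fun j ↦ gmono _) fun j ↦ gtend _)
  have rhs : Tendsto (fun n ↦ expNeg (lam * ∫⁻ z, ENNReal.ofReal (1 - expNeg (g n z)))) atTop
      (𝓝 (expNeg (lam * ∫⁻ z, ENNReal.ofReal (1 - expNeg (h z))))) := by
    refine (continuous_expNeg.tendsto _).comp (ENNReal.Tendsto.const_mul ?_ (by simp))
    refine lintegral_tendsto_of_tendsto_of_monotone (fun n ↦ ?_) ?_ ?_
    · exact (ENNReal.measurable_ofReal.comp
        (measurable_const.sub (measurable_expNeg.comp (gm n)))).aemeasurable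
    · refine Eventually.of_forall fun z n m hnm ↦ ENNReal.ofReal_le_ofReal ?_
      exact sub_le_sub_left (expNeg_antitone (gmono z hnm)) _
    · refine Eventually.of_forall fun z ↦ ?_
      exact (ENNReal.continuous_ofReal.tendsto _).comp
        (tendsto_const_nhds.sub ((continuous_expNeg.tendsto _).comp (gtend z)))
  exact tendsto_nhds_unique (lhs.congr step) rhs

end IsPoissonPointProcess

end LaplaceFunctional

/-! ### Sectors in polar coordinates -/

lemma measurable_angle : Measurable angle :=
  Measurable.ite (measurableSet_le measurable_const Complex.measurable_arg)
    Complex.measurable_arg (Complex.measurable_arg.add_const _)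

lemma measurableSet_sector (M : ℕ) (i : Fin M) : MeasurableSet (sector M i) :=
  measurable_angle measurableSet_Ico

lemma disjoint_sector {M : ℕ} {i j : Fin M} (hij : i ≠ j) :
    Disjoint (sector M i) (sector M j) := by
  have hM : (0 : ℝ) < M := by exact_mod_cast i.pos
  have hπ := Real.pi_pos
  have key : ∀ i j : Fin M, (i : ℕ) < j → Disjoint (sector M i) (sector M j) := by
    intro i j hij
    refine Set.disjoint_left.2 fun z hi hj ↦ ?_
    have h1 : ((i : ℕ) : ℝ) + 1 ≤ (j : ℕ) := by exact_mod_cast hij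
    have h2 : 2 * Real.pi * (((i : ℕ) : ℝ) + 1) / M ≤ 2 * Real.pi * (j : ℕ) / M := by gcongr
    exact absurd (hi.2.trans_le h2) (not_lt.2 hj.1)
  rcases lt_or_gt_of_ne (Fin.val_ne_of_ne hij) with h | h
  · exact key i j h
  · exact (key j i h).symm

/-- Polar coordinates use angles in `(-π, π)`, sectors angles in `[0, 2π)`: the part of `[a, b)`
beyond `π` is translated by `2π`, and the lost angle `π` is null. -/
lemma volume_angle_preimage {a b : ℝ} (ha : 0 ≤ a) (hb : b ≤ 2 * Real.pi) :
    volume {θ : ℝ | θ ∈ Ioo (-Real.pi) Real.pi ∧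
      (if 0 ≤ θ then θ else θ + 2 * Real.pi) ∈ Ico a b} = ENNReal.ofReal (b - a) := by
  set A := {θ : ℝ | θ ∈ Ioo (-Real.pi) Real.pi ∧
      (if 0 ≤ θ then θ else θ + 2 * Real.pi) ∈ Ico a b} with hA
  have hπ := Real.pi_pos
  have h1 : A ∩ Ici 0 = Ico a b ∩ Iio Real.pi := by
    ext θ
    simp only [hA, mem_inter_iff, mem_ofPred_eq, mem_Ioo, mem_Ico, mem_Ici, mem_Iio]
    constructor
    · rintro ⟨⟨h, h'⟩, h0⟩
      rw [if_pos h0] at h'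
      exact ⟨h', h.2⟩
    · rintro ⟨h, h'⟩
      have h0 : 0 ≤ θ := by linarith
      rw [if_pos h0]
      exact ⟨⟨⟨by linarith, h'⟩, h⟩, h0⟩
  have h2 : A \ Ici 0 = (fun θ ↦ θ + 2 * Real.pi) ⁻¹' (Ico a b ∩ Ioi Real.pi) := by
    ext θ
    simp only [hA, Set.mem_sdiff, mem_inter_iff, mem_ofPred_eq, mem_Ioo, mem_Ico, mem_Ici, mem_Ioi,
      mem_preimage]
    constructor
    · rintro ⟨⟨h, h'⟩, h0⟩
      rw [if_neg h0] at h'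
      exact ⟨h', by linarith⟩
    · rintro ⟨h, h'⟩
      have h0 : ¬ 0 ≤ θ := by linarith
      rw [if_neg h0]
      exact ⟨⟨⟨by linarith, by linarith⟩, h⟩, h0⟩
  have h3 : volume (Ico a b ∩ Ioi Real.pi) = volume (Ico a b \ Iio Real.pi) := by
    rw [Set.sdiff_eq, compl_Iio]
    exact measure_congr ((ae_eq_refl _).inter Ioi_ae_eq_Ici)
  rw [← measure_inter_add_sdiff A measurableSet_Ici, h1, h2, measure_preimage_add_right, h3,
    measure_inter_add_sdiff _ measurableSet_Iio, Real.volume_Ico]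

lemma setLIntegral_sq_mul (a : ℝ) {c : ℝ} (hc : 0 < c) (ha : 0 ≤ a) (g : ℝ → ℝ≥0∞) :
    ∫⁻ s in Ioi (c * a ^ 2), g s =
      ∫⁻ r in Ioi a, ENNReal.ofReal (2 * c * r) * g (c * r ^ 2) := by
  have him : (fun r : ℝ ↦ c * r ^ 2) '' Ioi a = Ioi (c * a ^ 2) := by
    ext s
    simp only [mem_image, mem_Ioi]
    constructor
    · rintro ⟨r, hr, rfl⟩
      gcongr
    · intro hs
      have h0 : a ^ 2 < s / c := by rw [lt_div_iff₀ hc]; linarith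
      refine ⟨√(s / c), ?_, ?_⟩
      · exact Real.lt_sqrt_of_sq_lt h0
      · rw [Real.sq_sqrt ((sq_nonneg a).trans h0.le)]
        field_simp
  rw [← him, lintegral_image_eq_lintegral_abs_deriv_mul measurableSet_Ioi
    (f' := fun r ↦ 2 * c * r)]
  · refine setLIntegral_congr_fun measurableSet_Ioi fun r hr ↦ ?_
    have : 0 < r := ha.trans_lt hr
    rw [abs_of_pos (by positivity)]
  · intro r _
    have := ((hasDerivAt_pow 2 r).const_mul c).hasDerivWithinAt (s := Ioi a)
    refine this.congr_deriv ?_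
    push_cast
    ring
  · intro r hr s hs hrs
    have hr0 : 0 < r := ha.trans_lt hr
    have hs0 : 0 < s := ha.trans_lt hs
    have : r ^ 2 = s ^ 2 := mul_left_cancel₀ hc.ne' hrs
    exact (pow_left_inj₀ hr0.le hs0.le two_ne_zero).1 this

/-- Integrals of radial functions over a sector. -/
theorem setLIntegral_sector {M : ℕ} (i : Fin M) {c : ℝ} (hc : 0 < c) {g : ℝ → ℝ≥0∞}
    (hg : Measurable g) :
    ∫⁻ z in sector M i, g (c * ‖z‖ ^ 2) =
      ENNReal.ofReal (Real.pi / (M * c)) * ∫⁻ s in Ioi (0 : ℝ), g s := by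
  have hM : (0 : ℝ) < M := by exact_mod_cast i.pos
  have hπ := Real.pi_pos
  set a := 2 * Real.pi * (i : ℕ) / M with ha
  set b := 2 * Real.pi * ((i : ℕ) + 1) / M with hb
  have ha0 : 0 ≤ a := by positivity
  have hb2 : b ≤ 2 * Real.pi := by
    rw [hb, div_le_iff₀ hM]
    have : ((i : ℕ) : ℝ) + 1 ≤ M := by exact_mod_cast i.2
    gcongr
  set A := {θ : ℝ | θ ∈ Ioo (-Real.pi) Real.pi ∧
      (if 0 ≤ θ then θ else θ + 2 * Real.pi) ∈ Ico a b} with hA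
  have hAm : MeasurableSet A := by
    refine measurableSet_Ioo.inter ?_
    have : Measurable fun θ : ℝ ↦ if 0 ≤ θ then θ else θ + 2 * Real.pi :=
      Measurable.ite measurableSet_Ici measurable_id (measurable_id.add_const _)
    exact this measurableSet_Ico
  rw [← lintegral_indicator (measurableSet_sector M i), ← Complex.lintegral_comp_polarCoord_symm]
  have e : ∀ p ∈ polarCoord.target, ENNReal.ofReal p.1 •
      (sector M i).indicator (fun z ↦ g (c * ‖z‖ ^ 2)) (Complex.polarCoord.symm p) =
      (ENNReal.ofReal p.1 * g (c * p.1 ^ 2)) * A.indicator (fun _ ↦ 1) p.2 := by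
    rintro ⟨r, θ⟩ ⟨hr, hθ⟩
    have hr : 0 < r := hr
    have harg : Complex.arg (Complex.polarCoord.symm (r, θ)) = θ := by
      rw [Complex.polarCoord_symm_apply]
      push_cast
      exact Complex.arg_mul_cos_add_sin_mul_I hr ⟨hθ.1, hθ.2.le⟩
    have hmem : Complex.polarCoord.symm (r, θ) ∈ sector M i ↔ θ ∈ A := by
      change angle _ ∈ Ico a b ↔ θ ∈ Ioo (-Real.pi) Real.pi ∧ _
      rw [angle, harg]
      exact (and_iff_right hθ).symm
    by_cases h : θ ∈ A
    · rw [indicator_of_mem (hmem.2 h), indicator_of_mem h, Complex.norm_polarCoord_symm,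
        smul_eq_mul, mul_one, sq_abs]
    · rw [indicator_of_notMem (fun h' ↦ h (hmem.1 h')), indicator_of_notMem h, smul_zero, mul_zero]
  rw [setLIntegral_congr_fun polarCoord.open_target.measurableSet e, polarCoord_target,
    Measure.volume_eq_prod, ← Measure.prod_restrict,
    lintegral_prod_mul (f := fun r ↦ ENNReal.ofReal r * g (c * r ^ 2)) (by fun_prop)
      ((measurable_const.indicator hAm).aemeasurable), lintegral_indicator_const hAm, one_mul,
    Measure.restrict_apply hAm, inter_eq_left.2 (fun θ h ↦ h.1), volume_angle_preimage ha0 hb2]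
  have := setLIntegral_sq_mul 0 hc le_rfl g
  rw [zero_pow two_ne_zero, mul_zero] at this
  rw [this]
  have e2 : ∀ r, ENNReal.ofReal (2 * c * r) * g (c * r ^ 2) =
      ENNReal.ofReal (2 * c) * (ENNReal.ofReal r * g (c * r ^ 2)) := by
    intro r
    rw [ENNReal.ofReal_mul (by positivity), mul_assoc]
  simp_rw [e2]
  rw [lintegral_const_mul _ (by fun_prop), ← mul_assoc, ← ENNReal.ofReal_mul (by positivity),
    mul_comm]
  congr 2
  rw [hb, ha]
  field_simp
  ring

/-! ### The logarithmic attenuation of an interferer -/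

/-- Minus the logarithm of the probability that an interferer at squared distance `s` does not
prevent the detection of a base station at squared distance `a`. -/
noncomputable def logLoss (Γ α a s : ℝ) : ℝ≥0∞ :=
  ENNReal.ofReal (Real.log (1 + Γ * (a / s) ^ (α / 2)))

lemma expNeg_logLoss {Γ α a s : ℝ} (hΓ : 0 < Γ) (ha : 0 ≤ a) (hs : 0 ≤ s) :
    expNeg (logLoss Γ α a s) = (1 + Γ * (a / s) ^ (α / 2))⁻¹ := by
  refine expNeg_ofReal_log ?_
  have : 0 ≤ (a / s) ^ (α / 2) := Real.rpow_nonneg (div_nonneg ha hs) _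
  linarith [mul_nonneg hΓ.le this]

lemma logLoss_mono {Γ α a b s : ℝ} (hΓ : 0 < Γ) (hα : 0 < α) (ha : 0 ≤ a) (hab : a ≤ b)
    (hs : 0 ≤ s) : logLoss Γ α a s ≤ logLoss Γ α b s := by
  have h1 : 0 ≤ a / s := div_nonneg ha hs
  have h2 : 0 ≤ (a / s) ^ (α / 2) := Real.rpow_nonneg h1 _
  have h3 : (a / s) ^ (α / 2) ≤ (b / s) ^ (α / 2) :=
    Real.rpow_le_rpow h1 (by gcongr) (by positivity)
  exact ENNReal.ofReal_le_ofReal (Real.log_le_log (by positivity) (by gcongr))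

/-- The substitution `s = a r²` turns `(a / s) ^ (α / 2)` into `r ^ (-α)` and `ds` into `2 a r dr`.
This scaling makes the exponent linear in `a`. -/
lemma setLIntegral_logLoss {Γ α a : ℝ} (hΓ : 0 < Γ) (ha : 0 < a) (k : ℕ) :
    ∫⁻ s in Ioi a, ENNReal.ofReal (1 - expNeg (k * logLoss Γ α a s)) =
      ENNReal.ofReal a * (2 * tailIntegral Γ α k) := by
  have h := setLIntegral_sq_mul 1 ha zero_le_one
    fun s ↦ ENNReal.ofReal (1 - expNeg (k * logLoss Γ α a s))
  rw [one_pow, mul_one] at h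
  rw [h, tailIntegral_eq, ← mul_assoc,
    ← lintegral_const_mul' _ _ (ENNReal.mul_ne_top ENNReal.ofReal_ne_top (by simp))]
  refine setLIntegral_congr_fun measurableSet_Ioi fun r hr ↦ ?_
  have hr0 : (0 : ℝ) < r := zero_lt_one.trans hr
  have e : (a / (a * r ^ 2)) ^ (α / 2) = 1 / r ^ α := by
    rw [div_mul_eq_div_div, div_self ha.ne', Real.div_rpow zero_le_one (by positivity),
      Real.one_rpow, ← Real.rpow_natCast, ← Real.rpow_mul hr0.le]
    congr 2
    push_cast
    ring
  rw [expNeg_nat_mul, expNeg_logLoss hΓ ha.le (by positivity), e, mul_one_div]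
  have h1 : 0 ≤ 1 - (1 + Γ / r ^ α)⁻¹ ^ k := sub_nonneg.2 (pow_le_one₀
    (inv_nonneg.2 (one_add_div_rpow_pos hΓ hr0.le).le)
    (inv_le_one_of_one_le₀ (one_le_one_add_div_rpow hΓ hr0.le)))
  rw [show (2 : ℝ≥0∞) = ENNReal.ofReal 2 by simp, ← ENNReal.ofReal_mul ha.le,
    ← ENNReal.ofReal_mul (by positivity), ← ENNReal.ofReal_mul (by positivity)]
  congr 1
  ring

/-! ### Almost sure properties of a Poisson configuration -/

/-- Configurations with no point at the origin, finitely many points in each ball, points in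
all sectors, and no two points at the same distance from the origin. -/
structure GoodConfig (M : ℕ) (y : ℕ → ℂ) : Prop where
  ne_zero : ∀ j, y j ≠ 0
  finite : ∀ R : ℝ, {j | ‖y j‖ ≤ R}.Finite
  nonempty : ∀ i : Fin M, ∃ j, y j ∈ sector M i
  injective : Function.Injective fun j ↦ ‖y j‖

lemma volume_radial (I : Set ℝ) (hI : MeasurableSet I) :
    volume {z : ℂ | Real.pi * ‖z‖ ^ 2 ∈ I} = volume (I ∩ Ioi 0) := by
  have hs : sector 1 0 = univ := by
    ext z
    have h1 := Complex.neg_pi_lt_arg z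
    have h2 := Complex.arg_le_pi z
    have hπ := Real.pi_pos
    simp only [sector, angle, mem_ofPred_eq, mem_univ, iff_true, mem_Ico]
    have h3 : ((0 : Fin 1) : ℕ) = 0 := rfl
    rw [h3, Nat.cast_zero, Nat.cast_one, mul_zero, zero_div, zero_add, mul_one, div_one]
    constructor <;> split_ifs <;> linarith
  have h := setLIntegral_sector (0 : Fin 1) Real.pi_pos (g := I.indicator fun _ ↦ 1)
    (measurable_const.indicator hI)
  have hm : MeasurableSet {z : ℂ | Real.pi * ‖z‖ ^ 2 ∈ I} := by
    have : Measurable fun z : ℂ ↦ Real.pi * ‖z‖ ^ 2 := by fun_prop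
    exact this hI
  have e : ∀ z : ℂ, I.indicator (fun _ ↦ (1 : ℝ≥0∞)) (Real.pi * ‖z‖ ^ 2) =
      {z : ℂ | Real.pi * ‖z‖ ^ 2 ∈ I}.indicator 1 z := fun z ↦ rfl
  simp_rw [e] at h
  rw [hs, Measure.restrict_univ, lintegral_indicator_one hm] at h
  rw [h, lintegral_indicator_const hI, Measure.restrict_apply hI]
  simp [Real.pi_ne_zero]

lemma volume_sector {M : ℕ} (i : Fin M) : volume (sector M i) = ∞ := by
  have hM : (0 : ℝ) < M := by exact_mod_cast i.pos
  have h := setLIntegral_sector i one_pos (g := fun _ ↦ 1) measurable_const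
  simp only [lintegral_const, one_mul, Measure.restrict_apply_univ, Real.volume_Ioi, mul_one] at h
  rw [h, ENNReal.mul_top]
  have := Real.pi_pos
  simp
  positivity

section AlmostSure

variable {Ω : Type*} [MeasurableSpace Ω] {μ : Measure Ω} {lam : ℝ≥0} {x : ℕ → Ω → ℂ}

namespace IsPoissonPointProcess

/-- From `e⁻ʳ ≥ 1 - r` one gets `1 - e⁻ʳ (1 + r) ≤ r²`. -/
lemma measure_two_le_count [IsProbabilityMeasure μ] (h : IsPoissonPointProcess μ lam x)
    {B : Set ℂ} (hB : MeasurableSet B) (hB' : volume B < ∞) :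
    μ {ω | 2 ≤ count x B ω} ≤ ((lam * (volume B).toNNReal) ^ 2 : ℝ≥0) := by
  have hm := measurable_count h.measurable hB
  set r : ℝ≥0 := lam * (volume B).toNNReal with hr
  have hmk : ∀ k : ℕ, MeasurableSet {ω | count x B ω = k} := fun k ↦
    hm (measurableSet_singleton _)
  have e : {ω | 2 ≤ count x B ω} = ({ω | count x B ω = (0 : ℕ)} ∪ {ω | count x B ω = (1 : ℕ)})ᶜ := by
    ext ω
    simp only [mem_ofPred_eq, mem_compl_iff, mem_union, not_or]
    rcases eq_or_ne (count x B ω) ⊤ with ht | ht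
    · simp [ht]
    · lift count x B ω to ℕ using ht with n
      norm_cast
      omega
  have hd : Disjoint {ω | count x B ω = (0 : ℕ)} {ω | count x B ω = (1 : ℕ)} := by
    refine Set.disjoint_left.2 fun ω h0 h1 ↦ ?_
    have := h0.symm.trans h1
    simp at this
  rw [e, prob_compl_eq_one_sub ((hmk 0).union (hmk 1)), measure_union hd (hmk 1),
    h.poisson B hB hB', h.poisson B hB hB', poissonMeasure_singleton, poissonMeasure_singleton,
    ← ENNReal.ofReal_add (by positivity) (by positivity), ← hr, tsub_le_iff_right,
    ← ENNReal.ofReal_coe_nnreal, ← ENNReal.ofReal_add (by positivity) (by positivity),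
    ← ENNReal.ofReal_one]
  refine ENNReal.ofReal_le_ofReal ?_
  have h1 := Real.add_one_le_exp (-(r : ℝ))
  have h2 : (0 : ℝ) ≤ r := r.2
  push_cast
  simp only [pow_zero, pow_one, Nat.factorial_zero, Nat.factorial_one, Nat.cast_one, mul_one, div_one]
  nlinarith

lemma ae_ne_zero [IsProbabilityMeasure μ] (h : IsPoissonPointProcess μ lam x) :
    ∀ᵐ ω ∂μ, ∀ j, x j ω ≠ 0 := by
  have h0 := h.poisson {0} (measurableSet_singleton 0) (by simp) 0
  have h1 : μ {ω | count x {0} ω = (0 : ℕ)} = 1 := by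
    rw [h0, poissonMeasure_singleton]
    simp
  have hm := measurable_count h.measurable (measurableSet_singleton (0 : ℂ))
  have h2 : ∀ᵐ ω ∂μ, count x {0} ω = (0 : ℕ) :=
    (mem_ae_iff_prob_eq_one (hm (measurableSet_singleton _))).2 h1
  filter_upwards [h2] with ω hω j hj
  rw [count, Nat.cast_zero, encard_eq_zero] at hω
  exact (hω ▸ notMem_empty j) hj

lemma ae_finite [IsProbabilityMeasure μ] (h : IsPoissonPointProcess μ lam x) :
    ∀ᵐ ω ∂μ, ∀ R : ℝ, {j | ‖x j ω‖ ≤ R}.Finite := by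
  have : ∀ᵐ ω ∂μ, ∀ n : ℕ, count x (Metric.closedBall 0 n) ω ≠ ⊤ :=
    ae_all_iff.2 fun n ↦ h.ae_count_ne_top Metric.isClosed_closedBall.measurableSet
      measure_closedBall_lt_top
  filter_upwards [this] with ω hω R
  refine (encard_ne_top_iff.1 (hω ⌈R⌉₊)).subset fun j hj ↦ ?_
  simpa using le_trans hj (Nat.le_ceil R)

/-- With weight `∞` on a sector, `expNeg` of the sum is the indicator that the sector is empty; its
mean vanishes since the sector has infinite area. -/
lemma ae_nonempty [IsProbabilityMeasure μ] (h : IsPoissonPointProcess μ lam x) (hlam : 0 < lam)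
    (M : ℕ) : ∀ᵐ ω ∂μ, ∀ i : Fin M, ∃ j, x j ω ∈ sector M i := by
  refine ae_all_iff.2 fun i ↦ ?_
  have hm : Measurable ((sector M i).indicator fun _ ↦ ∞) :=
    measurable_const.indicator (measurableSet_sector M i)
  have hL := h.integral_expNeg_tsum hm
  have e : ∀ z, ENNReal.ofReal (1 - expNeg ((sector M i).indicator (fun _ ↦ ∞) z)) =
      (sector M i).indicator 1 z := by
    intro z
    by_cases hz : z ∈ sector M i <;> simp [hz]
  simp_rw [e] at hL
  rw [lintegral_indicator_one (measurableSet_sector M i), volume_sector,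
    ENNReal.mul_top (by simpa using hlam.ne'), expNeg_top, integral_eq_zero_iff_of_nonneg
    (fun ω ↦ expNeg_nonneg _)] at hL
  · filter_upwards [hL] with ω hω
    by_contra! hc
    simp [hc] at hω
  · refine (integrable_const (1 : ℝ)).mono' (Measurable.aestronglyMeasurable ?_)
      (Eventually.of_forall fun ω ↦ norm_expNeg_le _)
    exact measurable_expNeg.comp (Measurable.tsum fun j ↦ hm.comp (h.measurable j))

/-- A tie within area `N` puts two points in one of `N (n + 1)` annuli of area `1 / (n + 1)`. The
union bound is `N λ² / (n + 1)`, which tends to `0`. Coinciding points are covered as well, because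
`count` respects multiplicity. -/
lemma ae_injective_norm [IsProbabilityMeasure μ] (h : IsPoissonPointProcess μ lam x) :
    ∀ᵐ ω ∂μ, Function.Injective fun j ↦ ‖x j ω‖ := by
  let T : ℕ → Set Ω := fun N ↦ {ω | ∃ j j', j ≠ j' ∧ ‖x j ω‖ = ‖x j' ω‖ ∧ Real.pi * ‖x j ω‖ ^ 2 < N}
  have hT : ∀ N, μ (T N) = 0 := by
    intro N
    have bound : ∀ n : ℕ, μ (T N) ≤ ((N * lam ^ 2 / (n + 1) : ℝ≥0) : ℝ≥0∞) := by
      intro n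
      let I : ℕ → Set ℝ := fun l ↦ Ico ((l : ℝ) / (n + 1)) (((l : ℝ) + 1) / (n + 1))
      let B : ℕ → Set ℂ := fun l ↦ {z | Real.pi * ‖z‖ ^ 2 ∈ I l}
      have hB : ∀ l, MeasurableSet (B l) := fun l ↦
        (by fun_prop : Measurable fun z : ℂ ↦ Real.pi * ‖z‖ ^ 2) measurableSet_Ico
      have hn : (0 : ℝ) < n + 1 := by positivity
      have hv : ∀ l, volume (B l) ≤ ((1 / (n + 1) : ℝ≥0) : ℝ≥0∞) := by
        intro l
        rw [volume_radial _ measurableSet_Ico]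
        refine (measure_mono inter_subset_left).trans ?_
        rw [Real.volume_Ico, ← ENNReal.ofReal_coe_nnreal]
        refine ENNReal.ofReal_le_ofReal ?_
        push_cast
        rw [← sub_div]
        simp
      have hsub : T N ⊆ ⋃ l ∈ Finset.range (N * (n + 1)), {ω | 2 ≤ count x (B l) ω} := by
        rintro ω ⟨j, j', hjj, heq, hN⟩
        have h0 : 0 ≤ Real.pi * ‖x j ω‖ ^ 2 * (n + 1) := by positivity
        simp only [mem_iUnion]
        have hf1 := Nat.floor_le h0
        have hf2 := Nat.lt_floor_add_one (Real.pi * ‖x j ω‖ ^ 2 * (n + 1))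
        refine ⟨⌊Real.pi * ‖x j ω‖ ^ 2 * (n + 1)⌋₊, ?_, ?_⟩
        · rw [Finset.mem_range, Nat.floor_lt h0]
          push_cast
          gcongr
        · have hj : x j ω ∈ B ⌊Real.pi * ‖x j ω‖ ^ 2 * (n + 1)⌋₊ := by
            change _ ∈ Ico _ _
            rw [mem_Ico, div_le_iff₀ hn, lt_div_iff₀ hn]
            exact ⟨hf1, hf2⟩
          have hj' : x j' ω ∈ B ⌊Real.pi * ‖x j ω‖ ^ 2 * (n + 1)⌋₊ := by
            change Real.pi * ‖x j' ω‖ ^ 2 ∈ I _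
            rw [← heq]
            exact hj
          change 2 ≤ Set.encard _
          rw [← encard_pair hjj]
          refine encard_le_encard ?_
          rintro k (rfl | rfl)
          exacts [hj, hj']
      calc μ (T N) ≤ ∑ l ∈ Finset.range (N * (n + 1)), μ {ω | 2 ≤ count x (B l) ω} :=
            (measure_mono hsub).trans (measure_biUnion_finset_le _ _)
        _ ≤ ∑ l ∈ Finset.range (N * (n + 1)), (((lam * (1 / (n + 1))) ^ 2 : ℝ≥0) : ℝ≥0∞) := by
            refine Finset.sum_le_sum fun l _ ↦ ?_
            refine (h.measure_two_le_count (hB l) ((hv l).trans_lt ENNReal.coe_lt_top)).trans ?_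
            have : (volume (B l)).toNNReal ≤ 1 / (n + 1) :=
              
              (ENNReal.toNNReal_mono ENNReal.coe_ne_top (hv l)).trans_eq (ENNReal.toNNReal_coe _)
            exact_mod_cast pow_le_pow_left' (mul_le_mul_right this lam) 2
        _ = ((N * lam ^ 2 / (n + 1) : ℝ≥0) : ℝ≥0∞) := by
            rw [Finset.sum_const, Finset.card_range, nsmul_eq_mul]
            norm_cast
            push_cast
            field_simp
    have ht : Tendsto (fun n : ℕ ↦ ((N * lam ^ 2 / (n + 1) : ℝ≥0) : ℝ≥0∞)) atTop (𝓝 0) := by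
      rw [← ENNReal.coe_zero]
      refine ENNReal.tendsto_coe.2 ?_
      rw [← NNReal.tendsto_coe]
      push_cast
      have := (tendsto_one_div_add_atTop_nhds_zero_nat (𝕜 := ℝ)).const_mul ((N : ℝ) * lam ^ 2)
      simpa [div_eq_mul_inv] using this
    exact le_antisymm (ge_of_tendsto' ht bound) zero_le
  have : ∀ᵐ ω ∂μ, ∀ N, ω ∉ T N := ae_all_iff.2 fun N ↦ measure_eq_zero_iff_ae_notMem.1 (hT N)
  filter_upwards [this] with ω hω j j' hjj
  by_contra hne
  obtain ⟨N, hN⟩ := exists_nat_gt (Real.pi * ‖x j ω‖ ^ 2)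
  exact hω N ⟨j, j', hne, hjj, hN⟩

theorem ae_goodConfig [IsProbabilityMeasure μ] (h : IsPoissonPointProcess μ lam x)
    (hlam : 0 < lam) (M : ℕ) : ∀ᵐ ω ∂μ, GoodConfig M fun j ↦ x j ω := by
  filter_upwards [h.ae_ne_zero, h.ae_finite, h.ae_nonempty hlam M, h.ae_injective_norm]
    with ω h1 h2 h3 h4 using ⟨h1, h2, h3, h4⟩

end IsPoissonPointProcess

end AlmostSure

/-! ### Independence of families over disjoint index sets -/

/-- Independence means that the joint law is a product measure, and an infinite product over pairs
is an iterated product. -/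
lemma iIndepFun_curry_sigma {Ω ι : Type*} [MeasurableSpace Ω] {μ : Measure Ω} {κ : ι → Type*}
    {X : (i : ι) → κ i → Ω → ℝ} (mX : ∀ i j, Measurable (X i j))
    (h : iIndepFun (fun (p : (i : ι) × κ i) ω ↦ X p.1 p.2 ω) μ) :
    iIndepFun (fun i ω (j : κ i) ↦ X i j ω) μ := by
  have := h.isProbabilityMeasure
  have : ∀ i j, IsProbabilityMeasure (μ.map (X i j)) :=
    fun i j ↦ Measure.isProbabilityMeasure_map (mX i j).aemeasurable
  have hc : (MeasurableEquiv.piCurry fun (i : ι) (_ : κ i) ↦ ℝ) ∘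
      (fun ω (p : (i : ι) × κ i) ↦ X p.1 p.2 ω) = fun ω i j ↦ X i j ω := by
    ext; simp [Sigma.curry]
  have hi : ∀ i, iIndepFun (X i) μ := fun i ↦
    h.precomp (g := fun j ↦ (⟨i, j⟩ : (i : ι) × κ i)) sigma_mk_injective
  rw [iIndepFun_iff_map_fun_eq_infinitePi_map (by fun_prop)]
  rw [iIndepFun_iff_map_fun_eq_infinitePi_map (by fun_prop)] at h
  rw [← hc, ← Measure.map_map (by fun_prop) (by fun_prop), h,
    Measure.infinitePi_map_piCurry (fun i j ↦ μ.map (X i j))]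
  congrm Measure.infinitePi fun i ↦ ?_
  rw [(iIndepFun_iff_map_fun_eq_infinitePi_map (by fun_prop)).1 (hi i)]

lemma iIndepFun_disjoint {Ω ι κ : Type*} [MeasurableSpace Ω] {μ : Measure Ω} {X : ι → Ω → ℝ}
    (mX : ∀ i, Measurable (X i)) (h : iIndepFun X μ) {J : κ → Set ι}
    (hJ : Pairwise fun a b ↦ Disjoint (J a) (J b)) :
    iIndepFun (fun a ω (j : J a) ↦ X j ω) μ := by
  refine iIndepFun_curry_sigma (X := fun a (j : J a) ↦ X j) (fun _ _ ↦ mX _) ?_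
  refine h.precomp (g := fun p : (a : κ) × J a ↦ (p.2 : ι)) ?_
  rintro ⟨a, j⟩ ⟨b, j'⟩ hjj
  have hjj : (j : ι) = j' := hjj
  by_cases hab : a = b
  · subst hab
    rw [Subtype.ext hjj]
  · exact absurd (hjj ▸ j'.2) (Set.disjoint_left.1 (hJ hab) j.2)

/-! ### Exponential random variables -/

instance isProbabilityMeasure_expMeasure_one : IsProbabilityMeasure (expMeasure 1) :=
  isProbabilityMeasure_expMeasure one_pos

lemma expMeasure_lt_ofReal (t : ℝ≥0∞) :
    expMeasure 1 {x | t < ENNReal.ofReal x} = ENNReal.ofReal (expNeg t) := by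
  by_cases ht : t = ∞
  · simp [ht]
  have e : {x | t < ENNReal.ofReal x} = (Iic t.toReal)ᶜ := by
    ext x
    simp [ENNReal.lt_ofReal_iff_toReal_lt ht]
  rw [e, ← ofReal_measureReal, measureReal_compl measurableSet_Iic, ← cdf_eq_real,
    cdf_expMeasure_eq one_pos, if_pos ENNReal.toReal_nonneg, expNeg_of_ne_top ht]
  simp

lemma integral_expNeg_mul_expMeasure {a : ℝ} (ha : 0 ≤ a) :
    ∫ x, expNeg (ENNReal.ofReal a * ENNReal.ofReal x) ∂expMeasure 1 =
      expNeg (ENNReal.ofReal (Real.log (1 + a))) := by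
  have hd : expMeasure 1 = volume.withDensity (exponentialPDF 1) := rfl
  have hm : Measurable (exponentialPDF 1) :=
    ENNReal.measurable_ofReal.comp (measurable_exponentialPDFReal 1)
  rw [expNeg_ofReal_log (by linarith), hd, integral_withDensity_eq_integral_toReal_smul hm
    (Eventually.of_forall fun x ↦ ENNReal.ofReal_lt_top)]
  have e : (fun x ↦ (exponentialPDF 1 x).toReal •
      expNeg (ENNReal.ofReal a * ENNReal.ofReal x)) =
      (Ici 0).indicator fun x ↦ Real.exp (-(1 + a) * x) := by
    ext x
    by_cases hx : 0 ≤ x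
    · rw [indicator_of_mem (mem_Ici.2 hx), ← ENNReal.ofReal_mul ha, expNeg_ofReal (by positivity),
        exponentialPDF_of_nonneg hx, ENNReal.toReal_ofReal (by positivity), smul_eq_mul, one_mul,
        one_mul, ← Real.exp_add]
      ring_nf
    · rw [indicator_of_notMem (by simpa using hx), exponentialPDF_of_neg (not_le.1 hx)]
      simp
  rw [e, integral_indicator measurableSet_Ici, integral_Ici_eq_integral_Ioi,
    integral_exp_mul_Ioi (by linarith)]
  rw [mul_zero, Real.exp_zero, neg_div_neg_eq, one_div]

section Fading

variable {Ω : Type*} [MeasurableSpace Ω] {μ : Measure Ω} {G : ℕ → Ω → ℝ}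

/-- The Laplace transform of a weighted sum of independent exponential variables. -/
lemma integral_expNeg_tsum_exponential (mG : ∀ j, Measurable (G j))
    (hG : ∀ j, μ.map (G j) = expMeasure 1) (hi : iIndepFun G μ) {a : ℕ → ℝ} (ha : ∀ j, 0 ≤ a j) :
    ∫ ω, expNeg (∑' j, ENNReal.ofReal (a j) * ENNReal.ofReal (G j ω)) ∂μ =
      expNeg (∑' j, ENNReal.ofReal (Real.log (1 + a j))) := by
  have := hi.isProbabilityMeasure
  have step : ∀ n, ∫ ω, expNeg (∑ j ∈ Finset.range n,
      ENNReal.ofReal (a j) * ENNReal.ofReal (G j ω)) ∂μ =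
      expNeg (∑ j ∈ Finset.range n, ENNReal.ofReal (Real.log (1 + a j))) := by
    intro n
    simp_rw [expNeg_sum, Finset.prod_range]
    have hi' : iIndepFun (fun j : Fin n ↦ G j) μ := hi.precomp Fin.val_injective
    rw [hi'.integral_fun_prod_comp (X := fun j : Fin n ↦ G j)
      (f := fun j x ↦ expNeg (ENNReal.ofReal (a j) * ENNReal.ofReal x))
      (fun j ↦ (mG j).aemeasurable) fun j ↦ Measurable.aestronglyMeasurable (by fun_prop)]
    refine Finset.prod_congr rfl fun j _ ↦ ?_
    rw [← integral_expNeg_mul_expMeasure (ha j), ← hG j, integral_map (mG j).aemeasurable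
      (Measurable.aestronglyMeasurable (by fun_prop))]
  have rhs : Tendsto (fun n ↦ expNeg (∑ j ∈ Finset.range n, ENNReal.ofReal (Real.log (1 + a j))))
      atTop (𝓝 (expNeg (∑' j, ENNReal.ofReal (Real.log (1 + a j))))) :=
    (continuous_expNeg.tendsto _).comp (ENNReal.tendsto_nat_tsum _)
  refine tendsto_nhds_unique (Tendsto.congr step ?_) rhs
  refine tendsto_integral_of_dominated_convergence (fun _ ↦ 1)
    (fun n ↦ Measurable.aestronglyMeasurable (by fun_prop)) (integrable_const _)
    (fun n ↦ Eventually.of_forall fun ω ↦ norm_expNeg_le _) (Eventually.of_forall fun ω ↦ ?_)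
  exact (continuous_expNeg.tendsto _).comp (ENNReal.tendsto_nat_tsum _)

/-- Fubini together with `P(H > t) = e⁻ᵗ`, valid also at `t = ∞`. -/
lemma measure_lt_exponential [IsProbabilityMeasure μ] {T : Ω → ℝ≥0∞} {H : Ω → ℝ}
    (mT : Measurable T) (mH : Measurable H) (hH : μ.map H = expMeasure 1) (hi : IndepFun T H μ) :
    μ.real {ω | T ω < ENNReal.ofReal (H ω)} = ∫ ω, expNeg (T ω) ∂μ := by
  have hp := (indepFun_iff_map_prod_eq_prod_map_map mT.aemeasurable mH.aemeasurable).1 hi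
  have hS : MeasurableSet {p : ℝ≥0∞ × ℝ | p.1 < ENNReal.ofReal p.2} :=
    measurableSet_lt (by fun_prop) (by fun_prop)
  have e : {ω | T ω < ENNReal.ofReal (H ω)} =
      (fun ω ↦ (T ω, H ω)) ⁻¹' {p : ℝ≥0∞ × ℝ | p.1 < ENNReal.ofReal p.2} := rfl
  rw [measureReal_def, e, ← Measure.map_apply (by fun_prop) hS, hp, hH, Measure.prod_apply hS]
  have e2 : ∀ t : ℝ≥0∞, expMeasure 1 (Prod.mk t ⁻¹' {p : ℝ≥0∞ × ℝ | p.1 < ENNReal.ofReal p.2}) =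
      ENNReal.ofReal (expNeg t) := fun t ↦ expMeasure_lt_ofReal t
  simp_rw [e2]
  rw [lintegral_map (by fun_prop) mT, integral_eq_lintegral_of_nonneg_ae
    (Eventually.of_forall fun ω ↦ expNeg_nonneg _)
    (Measurable.aestronglyMeasurable (by fun_prop))]

/-- The probability that an exponential variable exceeds a weighted sum of other ones. -/
lemma measure_tsum_lt_exponential (mG : ∀ j, Measurable (G j))
    (hG : ∀ j, μ.map (G j) = expMeasure 1) (hi : iIndepFun G μ) {a : ℕ → ℝ} (ha : ∀ j, 0 ≤ a j)
    {k : ℕ} (hk : a k = 0) :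
    μ.real {ω | ∑' j, ENNReal.ofReal (a j) * ENNReal.ofReal (G j ω) < ENNReal.ofReal (G k ω)} =
      expNeg (∑' j, ENNReal.ofReal (Real.log (1 + a j))) := by
  have := hi.isProbabilityMeasure
  rw [← integral_expNeg_tsum_exponential mG hG hi ha]
  refine measure_lt_exponential (by fun_prop) (mG k) (hG k) ?_
  -- Since `a k = 0`, the sum involves only the variables of index other than `k` and is therefore
  -- independent of `G k`.
  let J : Bool → Set ℕ := fun b ↦ if b then {k}ᶜ else {k}
  have hJ : Pairwise fun a b ↦ Disjoint (J a) (J b) := by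
    intro a b hab
    cases a <;> cases b <;> simp [J] at hab ⊢
  have h2 := (iIndepFun_disjoint mG hi hJ).indepFun (i := true) (j := false) (by simp)
  have hkJ : k ∈ J false := by simp [J]
  have hm : Measurable fun g : J false → ℝ ↦ g ⟨k, hkJ⟩ :=
    measurable_pi_apply (X := fun _ : J false ↦ ℝ) _
  have h3 := h2.comp 
    (φ := fun g : J true → ℝ ↦ ∑' j : J true, ENNReal.ofReal (a j) * ENNReal.ofReal (g j))
    (ψ := fun g : J false → ℝ ↦ g ⟨k, hkJ⟩) (by fun_prop) hm
  have e : (fun ω ↦ ∑' j, ENNReal.ofReal (a j) * ENNReal.ofReal (G j ω)) =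
      fun ω ↦ ∑' j : J true, ENNReal.ofReal (a j) * ENNReal.ofReal (G j ω) := by
    ext ω
    refine (tsum_subtype_eq_of_support_subset
      (f := fun j ↦ ENNReal.ofReal (a j) * ENNReal.ofReal (G j ω)) ?_).symm
    intro j hj
    simp only [J, if_true, mem_compl_iff, mem_singleton_iff]
    rintro rfl
    simp [hk] at hj
  rw [e]
  exact h3

end Fading

/-! ### Detection for a fixed configuration -/

/-- The logarithmic attenuation due to an interferer at `z`, in sector `i` and outside the disc on
which `c * ‖z‖ ^ 2 ≤ a`. -/
noncomputable def outerLoss (Γ α c : ℝ) (M : ℕ) (i : Fin M) (a : ℝ) : ℂ → ℝ≥0∞ :=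
  (sector M i ∩ {z | a < c * ‖z‖ ^ 2}).indicator fun z ↦ logLoss Γ α a (c * ‖z‖ ^ 2)

/-- `k i` is the index of the point of the configuration nearest to the origin in sector `i`. -/
def IsNearest (M : ℕ) (y : ℕ → ℂ) (k : Fin M → ℕ) : Prop :=
  ∀ i, y (k i) ∈ sector M i ∧ ∀ j, y j ∈ sector M i → j ≠ k i → ‖y (k i)‖ < ‖y j‖

lemma GoodConfig.exists_isNearest {M : ℕ} {y : ℕ → ℂ} (hy : GoodConfig M y) :
    ∃ k, IsNearest M y k := by
  have : ∀ i, ∃ k, y k ∈ sector M i ∧ ∀ j, y j ∈ sector M i → j ≠ k → ‖y k‖ < ‖y j‖ := by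
    intro i
    obtain ⟨j₀, hj₀⟩ := hy.nonempty i
    have hf : {j | y j ∈ sector M i ∧ ‖y j‖ ≤ ‖y j₀‖}.Finite :=
      (hy.finite ‖y j₀‖).subset fun j hj ↦ hj.2
    obtain ⟨k, hk, hmin⟩ := exists_min_image _ (fun j ↦ ‖y j‖) hf ⟨j₀, hj₀, le_rfl⟩
    refine ⟨k, hk.1, fun j hj hjk ↦ lt_of_le_of_ne ?_ fun h ↦ hjk (hy.injective h.symm)⟩
    by_cases h : ‖y j‖ ≤ ‖y j₀‖
    · exact hmin j ⟨hj, h⟩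
    · exact hk.2.trans (not_le.1 h).le
  choose k hk using this
  exact ⟨k, hk⟩

/-- The weight of the fading of link `j` in the event that sector `i` is detected with serving
base station `k`. -/
noncomputable def weight (Γ α : ℝ) (M : ℕ) (i : Fin M) (y : ℕ → ℂ) (k j : ℕ) : ℝ :=
  {j | y j ∈ sector M i ∧ j ≠ k}.indicator (fun j ↦ Γ * (‖y k‖ / ‖y j‖) ^ α) j

lemma weight_nonneg {Γ α : ℝ} (hΓ : 0 < Γ) (M : ℕ) (i : Fin M) (y : ℕ → ℂ) (k j : ℕ) :
    0 ≤ weight Γ α M i y k j :=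
  indicator_nonneg (fun j _ ↦ mul_nonneg hΓ.le (Real.rpow_nonneg (by positivity) _)) j

section Config

variable {Γ α C P : ℝ} {M : ℕ} {y : ℕ → ℂ} {k : Fin M → ℕ}

lemma lt_sinr_iff (hΓ : 0 < Γ) (hC : 0 < C) (hy : GoodConfig M y) (i : Fin M) (k : ℕ)
    (f : ℕ → ℝ) :
    ENNReal.ofReal Γ < sinr (pathLoss C α) 0 P M i y f k ↔
      ∑' j, ENNReal.ofReal (weight Γ α M i y k j) * ENNReal.ofReal (f j) <
        ENNReal.ofReal (f k) := by
  have hn : ∀ j, 0 < ‖y j‖ := fun j ↦ norm_pos_iff.2 (hy.ne_zero j)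
  have hl : ∀ j, 0 < pathLoss C α ‖y j‖ := fun j ↦ mul_pos hC (Real.rpow_pos_of_pos (hn j) _)
  have hΓ0 : ENNReal.ofReal Γ ≠ 0 := by simpa using hΓ
  have hl0 : ENNReal.ofReal (pathLoss C α ‖y k‖) ≠ 0 := by simpa using hl k
  -- In clearing the denominator, finiteness of `Γ` covers zero interference and positivity of `Γ`
  -- covers infinite interference.
  rw [sinr, zero_div, ENNReal.ofReal_zero, add_zero,
    ENNReal.lt_div_iff_mul_lt (Or.inr ENNReal.ofReal_ne_top) (Or.inr hΓ0), rxPower,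
    ENNReal.lt_div_iff_mul_lt (Or.inl hl0) (Or.inl ENNReal.ofReal_ne_top), interference]
  have hts : ∑' j : {j // y j ∈ sector M i ∧ j ≠ k}, rxPower (pathLoss C α) (y j) (f j) = _ :=
    tsum_subtype {j | y j ∈ sector M i ∧ j ≠ k} fun j ↦ rxPower (pathLoss C α) (y j) (f j)
  rw [hts, ← ENNReal.tsum_mul_left, ← ENNReal.tsum_mul_right]
  refine iff_of_eq (congrArg₂ _ (tsum_congr fun j ↦ ?_) rfl)
  by_cases hj : j ∈ {j | y j ∈ sector M i ∧ j ≠ k}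
  · rw [weight, indicator_of_mem hj, indicator_of_mem hj, rxPower,
      ← ENNReal.ofReal_div_of_pos (hl j), ← ENNReal.ofReal_mul hΓ.le,
      ← ENNReal.ofReal_mul' (hl k).le,
      ← ENNReal.ofReal_mul (mul_nonneg hΓ.le (Real.rpow_nonneg (by positivity) _))]
    congr 1
    rw [pathLoss, pathLoss, Real.div_rpow (hn k).le (hn j).le]
    have := Real.rpow_pos_of_pos (hn j) α
    field_simp
  · rw [weight, indicator_of_notMem hj, indicator_of_notMem hj]
    simp

lemma sectorDetected_iff (hΓ : 0 < Γ) (hα : 0 < α) (hC : 0 < C) (hy : GoodConfig M y)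
    (hk : IsNearest M y k) (i : Fin M) (f : ℕ → ℝ) :
    SectorDetected (pathLoss C α) 0 P Γ M i y f ↔
      ∑' j, ENNReal.ofReal (weight Γ α M i y (k i) j) * ENNReal.ofReal (f j) <
        ENNReal.ofReal (f (k i)) := by
  have hmono : ∀ a b : ℝ, 0 ≤ a → a < b → pathLoss C α a < pathLoss C α b := fun a b ha hab ↦
    mul_lt_mul_of_pos_left (Real.rpow_lt_rpow ha hab hα) hC
  rw [← lt_sinr_iff (P := P) hΓ hC hy]
  constructor
  · rintro ⟨l, hl, hmin, hs⟩
    have : l = k i := by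
      by_contra hne
      have h1 := (hk i).2 l hl hne
      exact absurd (hmin (k i) (hk i).1) (not_le.2 (hmono _ _ (norm_nonneg _) h1))
    rwa [← this]
  · intro hs
    refine ⟨k i, (hk i).1, fun j hj ↦ ?_, hs⟩
    by_cases hjk : j = k i
    · rw [hjk]
    · exact (hmono _ _ (norm_nonneg _) ((hk i).2 j hj hjk)).le

/-- As the nearest point is strictly nearest, the interferers of the sector are exactly its points
outside the closed disc through that point. The sum thus becomes an additive functional of the
configuration, with no exclusion of an index. -/
lemma tsum_log_weight {c : ℝ} (hc : 0 < c) (hk : IsNearest M y k) (i : Fin M) :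
    ∑' j, ENNReal.ofReal (Real.log (1 + weight Γ α M i y (k i) j)) =
      ∑' j, outerLoss Γ α c M i (c * ‖y (k i)‖ ^ 2) (y j) := by
  refine tsum_congr fun j ↦ ?_
  by_cases hj : y j ∈ sector M i ∧ j ≠ k i
  · have h1 : c * ‖y (k i)‖ ^ 2 < c * ‖y j‖ ^ 2 := by
      have := (hk i).2 j hj.1 hj.2
      gcongr
    have h2 : y j ∈ sector M i ∩ {z | c * ‖y (k i)‖ ^ 2 < c * ‖z‖ ^ 2} := ⟨hj.1, h1⟩
    rw [outerLoss, indicator_of_mem h2, logLoss, weight,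
      indicator_of_mem (show j ∈ {j | y j ∈ sector M i ∧ j ≠ k i} from hj),
      mul_div_mul_left _ _ hc.ne', ← div_pow, ← Real.rpow_natCast,
      ← Real.rpow_mul (by positivity)]
    congr 5
    push_cast
    ring
  · rw [outerLoss, weight, indicator_of_notMem
      (show j ∉ {j | y j ∈ sector M i ∧ j ≠ k i} from hj), indicator_of_notMem]
    · simp
    · rintro ⟨h1, h2⟩
      rcases not_and_or.1 hj with h | h
      · exact h h1
      · rw [not_not.1 h] at h2
        exact lt_irrefl (c * ‖y (k i)‖ ^ 2) h2

/-- The probability that no sector is detected, for a fixed configuration of base stations. -/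
theorem measure_not_success {Ω : Type*} [MeasurableSpace Ω] {μ : Measure Ω} {G : ℕ → Ω → ℝ}
    (mG : ∀ j, Measurable (G j)) (hG : ∀ j, μ.map (G j) = expMeasure 1) (hi : iIndepFun G μ)
    (hΓ : 0 < Γ) (hα : 0 < α) (hC : 0 < C) {c : ℝ} (hc : 0 < c)
    (hy : GoodConfig M y) (hk : IsNearest M y k) :
    μ.real {ω | ¬ Success (pathLoss C α) 0 P Γ M y fun j ↦ G j ω} =
      ∏ i, (1 - expNeg (∑' j, outerLoss Γ α c M i (c * ‖y (k i)‖ ^ 2) (y j))) := by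
  have := hi.isProbabilityMeasure
  -- Detection in sector `i` depends only on the fading of links from that sector, and these index
  -- sets are disjoint.
  let J : Fin M → Set ℕ := fun i ↦ {j | y j ∈ sector M i}
  have hJ : Pairwise fun a b ↦ Disjoint (J a) (J b) := fun a b hab ↦
    (disjoint_sector hab).preimage y
  let E : (i : Fin M) → Set (J i → ℝ) := fun i ↦
    {g | ∑' j : J i, ENNReal.ofReal (weight Γ α M i y (k i) j) * ENNReal.ofReal (g j) <
      ENNReal.ofReal (g ⟨k i, (hk i).1⟩)}
  have hE : ∀ i, MeasurableSet (E i) := fun i ↦ measurableSet_lt (by fun_prop) (by fun_prop)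
  let D : Fin M → Set Ω := fun i ↦
    {ω | ∑' j, ENNReal.ofReal (weight Γ α M i y (k i) j) * ENNReal.ofReal (G j ω) <
      ENNReal.ofReal (G (k i) ω)}
  have hDm : ∀ i, MeasurableSet (D i) := fun i ↦ measurableSet_lt (by fun_prop) (by fun_prop)
  have hDE : ∀ i, D i = (fun ω (j : J i) ↦ G j ω) ⁻¹' E i := by
    intro i
    ext ω
    simp only [D, E, mem_ofPred_eq, mem_preimage]
    rw [← tsum_subtype_eq_of_support_subset (s := J i)]
    intro j hj
    by_contra hjJ
    refine hj ?_
    simp only [weight]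
    rw [indicator_of_notMem fun h ↦ hjJ h.1]
    simp
  have e : {ω | ¬ Success (pathLoss C α) 0 P Γ M y fun j ↦ G j ω} = ⋂ i, (D i)ᶜ := by
    ext ω
    simp only [Success, sectorDetected_iff hΓ hα hC hy hk, mem_ofPred_eq, not_exists, mem_iInter,
      mem_compl_iff, D]
  rw [e, measureReal_def, (iIndepFun_disjoint mG hi hJ).meas_iInter, ENNReal.toReal_prod]
  · refine Finset.prod_congr rfl fun i _ ↦ ?_
    rw [← measureReal_def, probReal_compl_eq_one_sub (hDm i), measure_tsum_lt_exponential mG hG hi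
      (weight_nonneg hΓ M i y (k i)), tsum_log_weight hc hk]
    rw [weight, indicator_of_notMem]
    simp
  · intro i
    rw [hDE i]
    exact ⟨(E i)ᶜ, (hE i).compl, rfl⟩

end Config

/-! ### Dyadic discretization of the distance of the serving base station -/

section Dyadic

variable {t : ℝ}

lemma lt_dyadic (t : ℝ) (m : ℕ) : t < ((⌊t * 2 ^ m⌋₊ : ℝ) + 1) / 2 ^ m := by
  rw [lt_div_iff₀ (by positivity)]
  exact Nat.lt_floor_add_one _

lemma monotone_dyadic (ht : 0 ≤ t) : Monotone fun m : ℕ ↦ (⌊t * 2 ^ m⌋₊ : ℝ) / 2 ^ m := by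
  refine monotone_nat_of_le_succ fun m ↦ ?_
  have h : 2 * ⌊t * 2 ^ m⌋₊ ≤ ⌊t * 2 ^ (m + 1)⌋₊ := by
    refine Nat.le_floor ?_
    have := Nat.floor_le (show 0 ≤ t * 2 ^ m by positivity)
    push_cast
    rw [pow_succ]
    linarith
  have h' : (2 : ℝ) * ⌊t * 2 ^ m⌋₊ ≤ ⌊t * 2 ^ (m + 1)⌋₊ := by exact_mod_cast h
  calc (⌊t * 2 ^ m⌋₊ : ℝ) / 2 ^ m = 2 * ⌊t * 2 ^ m⌋₊ / 2 ^ (m + 1) := by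
        rw [pow_succ, mul_comm 2 (⌊t * 2 ^ m⌋₊ : ℝ), mul_div_mul_right _ _ two_ne_zero]
    _ ≤ _ := by gcongr

lemma antitone_dyadic (ht : 0 ≤ t) :
    Antitone fun m : ℕ ↦ ((⌊t * 2 ^ m⌋₊ : ℝ) + 1) / 2 ^ m := by
  refine antitone_nat_of_succ_le fun m ↦ ?_
  have h : ⌊t * 2 ^ (m + 1)⌋₊ < 2 * (⌊t * 2 ^ m⌋₊ + 1) := by
    rw [Nat.floor_lt (by positivity)]
    have := Nat.lt_floor_add_one (t * 2 ^ m)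
    push_cast
    rw [pow_succ]
    linarith
  have h' : (⌊t * 2 ^ (m + 1)⌋₊ : ℝ) + 1 ≤ 2 * (⌊t * 2 ^ m⌋₊ + 1) := by exact_mod_cast h
  calc ((⌊t * 2 ^ (m + 1)⌋₊ : ℝ) + 1) / 2 ^ (m + 1)
      ≤ 2 * (⌊t * 2 ^ m⌋₊ + 1) / 2 ^ (m + 1) := by gcongr
    _ = _ := by rw [pow_succ, mul_comm 2 ((⌊t * 2 ^ m⌋₊ : ℝ) + 1), mul_div_mul_right _ _ two_ne_zero]

lemma tendsto_dyadic (ht : 0 ≤ t) :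
    Tendsto (fun m : ℕ ↦ (⌊t * 2 ^ m⌋₊ : ℝ) / 2 ^ m) atTop (𝓝 t) :=
  (tendsto_nat_floor_mul_div_atTop ht).comp (tendsto_pow_atTop_atTop_of_one_lt one_lt_two)

lemma tendsto_dyadic_add_one (ht : 0 ≤ t) :
    Tendsto (fun m : ℕ ↦ ((⌊t * 2 ^ m⌋₊ : ℝ) + 1) / 2 ^ m) atTop (𝓝 t) := by
  have h := (tendsto_dyadic ht).add
    (tendsto_pow_atTop_nhds_zero_of_lt_one (r := (1 / 2 : ℝ)) (by norm_num) (by norm_num))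
  rw [add_zero] at h
  refine h.congr fun m ↦ ?_
  rw [add_div, one_div_pow]

/-- Summation over the dyadic cells picks out the cell containing `t`. -/
lemma sum_dyadic (ht : 0 ≤ t) (m : ℕ) (φ : ℕ → ℝ) :
    ∑ l ∈ Finset.range (m * 2 ^ m), φ l * ((if (l : ℝ) / 2 ^ m ≤ t then 1 else 0) -
      (if ((l : ℝ) + 1) / 2 ^ m ≤ t then 1 else 0)) =
      if t < m then φ ⌊t * 2 ^ m⌋₊ else 0 := by
  have hp : (0 : ℝ) < 2 ^ m := by positivity
  have h0 : 0 ≤ t * 2 ^ m := by positivity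
  have h1 : ∀ l : ℕ, (l : ℝ) / 2 ^ m ≤ t ↔ l ≤ ⌊t * 2 ^ m⌋₊ := fun l ↦ by
    rw [div_le_iff₀ hp, Nat.le_floor_iff h0]
  have h2 : ∀ l : ℕ, ((l : ℝ) + 1) / 2 ^ m ≤ t ↔ l + 1 ≤ ⌊t * 2 ^ m⌋₊ := fun l ↦ by
    rw [← h1]; push_cast; rfl
  have h3 : t < m ↔ ⌊t * 2 ^ m⌋₊ ∈ Finset.range (m * 2 ^ m) := by
    rw [Finset.mem_range, Nat.floor_lt h0]
    push_cast
    exact (mul_lt_mul_iff_left₀ hp).symm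
  have h4 : ∀ l : ℕ, φ l * ((if (l : ℝ) / 2 ^ m ≤ t then 1 else 0) -
      (if ((l : ℝ) + 1) / 2 ^ m ≤ t then 1 else 0)) =
      if ⌊t * 2 ^ m⌋₊ = l then φ l else 0 := by
    intro l
    simp only [h1, h2]
    split_ifs <;> first | omega | simp
  simp_rw [h4, h3]
  exact Finset.sum_ite_eq _ _ _

end Dyadic

/-- Dyadic approximation from below of `logLoss`, for a serving base station in cell `l`. -/
noncomputable def gridLoss (Γ α : ℝ) (m l : ℕ) (s : ℝ) : ℝ≥0∞ :=
  if ((l : ℝ) + 1) / 2 ^ m ≤ s then logLoss Γ α (l / 2 ^ m) s else 0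

@[fun_prop] lemma measurable_gridLoss (Γ α : ℝ) (m l : ℕ) : Measurable (gridLoss Γ α m l) := by
  have h : Measurable fun s ↦ logLoss Γ α (l / 2 ^ m) s := by unfold logLoss; fun_prop
  exact Measurable.ite (measurableSet_le measurable_const measurable_id) h measurable_const

/-- Refinement raises the lower end of the cell, which enters the loss, and lowers the upper end,
which is the cut-off; both increase the value. This allows monotone convergence. -/
lemma monotone_gridLoss {Γ α t s : ℝ} (hΓ : 0 < Γ) (hα : 0 < α) (ht : 0 ≤ t) (hs : 0 ≤ s) :
    Monotone fun m ↦ gridLoss Γ α m ⌊t * 2 ^ m⌋₊ s := by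
  intro m n hmn
  simp only [gridLoss]
  split_ifs with h1 h2
  · exact logLoss_mono hΓ hα (by positivity) (monotone_dyadic ht hmn) hs
  · exact absurd ((antitone_dyadic ht hmn).trans h1) h2
  · exact zero_le
  · exact le_rfl

lemma tendsto_gridLoss {Γ α t s : ℝ} (hΓ : 0 < Γ) (hα : 0 < α) (ht : 0 ≤ t) :
    Tendsto (fun m ↦ gridLoss Γ α m ⌊t * 2 ^ m⌋₊ s) atTop
      (𝓝 (if t < s then logLoss Γ α t s else 0)) := by
  split_ifs with h
  · have hs : 0 < s := ht.trans_lt h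
    have hc : ContinuousAt (fun a ↦ logLoss Γ α a s) t := by
      refine ENNReal.continuous_ofReal.continuousAt.comp (ContinuousAt.log ?_ ?_)
      · exact continuousAt_const.add (continuousAt_const.mul
          ((continuousAt_id.div_const s).rpow_const (Or.inr (by positivity))))
      · have : 0 ≤ (t / s) ^ (α / 2) := Real.rpow_nonneg (by positivity) _
        positivity
    refine (hc.tendsto.comp (tendsto_dyadic ht)).congr' ?_
    filter_upwards [(tendsto_dyadic_add_one ht).eventually_lt_const h] with m hm
    rw [gridLoss, if_pos hm.le]
    rfl
  · refine tendsto_const_nhds.congr fun m ↦ ?_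
    rw [gridLoss, if_neg]
    exact not_le.2 ((not_lt.1 h).trans_lt (lt_dyadic t m))

/-- The exponent of the void probability of the inner disc and of the attenuation by the
interferers, raised to the power `p.1`, for the dyadic cell `p.2.1` of level `m`; for `p.2.2 = 1`
the cell itself is added to the inner disc. -/
noncomputable def cellLoss (Γ α c : ℝ) (M : ℕ) (m : ℕ) (i : Fin M) (p : ℕ × ℕ × ℕ) : ℂ → ℝ≥0∞ :=
  (sector M i).indicator fun z ↦
    (if c * ‖z‖ ^ 2 < ((p.2.1 : ℝ) + p.2.2) / 2 ^ m then ∞ else 0) +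
      p.1 * gridLoss Γ α m p.2.1 (c * ‖z‖ ^ 2)

lemma measurable_cellLoss (Γ α c : ℝ) (M : ℕ) (m : ℕ) (i : Fin M) (p : ℕ × ℕ × ℕ) :
    Measurable (cellLoss Γ α c M m i p) := by
  refine Measurable.indicator (Measurable.add ?_ (by fun_prop)) (measurableSet_sector M i)
  exact Measurable.ite (measurableSet_lt (by fun_prop) measurable_const) measurable_const
    measurable_const

/-- The index set of the discretization. -/
def cellIndex (n m : ℕ) : Finset (ℕ × ℕ × ℕ) :=
  Finset.range (n + 1) ×ˢ Finset.range (m * 2 ^ m) ×ˢ Finset.range 2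

/-- The coefficients of the discretization. -/
def cellCoeff (n : ℕ) (p : ℕ × ℕ × ℕ) : ℝ :=
  (-1) ^ p.1 * (n.choose p.1 : ℝ) * (-1) ^ p.2.2

lemma one_sub_pow_eq_sum (n : ℕ) (q : ℝ) :
    (1 - q) ^ n = ∑ k ∈ Finset.range (n + 1), (-1) ^ k * (n.choose k : ℝ) * q ^ k := by
  rw [show 1 - q = -q + 1 by ring, add_pow]
  refine Finset.sum_congr rfl fun k _ ↦ ?_
  rw [neg_pow]
  ring

/-- Evaluation of the discretized sum. -/
lemma sum_cellIndex {t : ℝ} (ht : 0 ≤ t) (n m : ℕ) (φ : ℕ → ℕ → ℝ) :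
    ∑ p ∈ cellIndex n m, cellCoeff n p *
      ((if ((p.2.1 : ℝ) + p.2.2) / 2 ^ m ≤ t then 1 else 0) * φ p.1 p.2.1) =
      if t < m then ∑ k ∈ Finset.range (n + 1), (-1) ^ k * (n.choose k : ℝ) * φ k ⌊t * 2 ^ m⌋₊
        else 0 := by
  rw [cellIndex, Finset.sum_product, ← sum_dyadic ht m fun l ↦
    ∑ k ∈ Finset.range (n + 1), (-1) ^ k * (n.choose k : ℝ) * φ k l]
  simp_rw [Finset.sum_product, Finset.sum_range_succ _ 1, Finset.sum_range_one, Finset.sum_mul]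
  rw [Finset.sum_comm]
  refine Finset.sum_congr rfl fun l _ ↦ Finset.sum_congr rfl fun k _ ↦ ?_
  simp only [cellCoeff, Nat.cast_zero, Nat.cast_one, add_zero, pow_zero, pow_one]
  ring

section Config

variable {Γ α c : ℝ} {M : ℕ} {y : ℕ → ℂ} {k : Fin M → ℕ}

/-- The discretized attenuation of sector `i`. -/
noncomputable def gridProb (Γ α c : ℝ) (M m : ℕ) (i : Fin M) (l : ℕ) (y : ℕ → ℂ) : ℝ :=
  expNeg (∑' j, (sector M i).indicator (fun z ↦ gridLoss Γ α m l (c * ‖z‖ ^ 2)) (y j))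

/-- The infinite weight annihilates configurations with a sector point below the level, so it acts
as the indicator that the nearest point is not below it. -/
lemma expNeg_tsum_cellLoss (hc : 0 < c) (hk : IsNearest M y k) (m : ℕ) (i : Fin M)
    (p : ℕ × ℕ × ℕ) :
    expNeg (∑' j, cellLoss Γ α c M m i p (y j)) =
      (if ((p.2.1 : ℝ) + p.2.2) / 2 ^ m ≤ c * ‖y (k i)‖ ^ 2 then 1 else 0) *
        gridProb Γ α c M m i p.2.1 y ^ p.1 := by
  set a := ((p.2.1 : ℝ) + p.2.2) / 2 ^ m with ha
  have e : ∀ z, cellLoss Γ α c M m i p z =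
      (sector M i).indicator (fun z ↦ if c * ‖z‖ ^ 2 < a then ∞ else 0) z +
      p.1 * (sector M i).indicator (fun z ↦ gridLoss Γ α m p.2.1 (c * ‖z‖ ^ 2)) z := by
    intro z
    by_cases hz : z ∈ sector M i <;> simp [cellLoss, hz, ha]
  simp_rw [e]
  rw [ENNReal.tsum_add, ENNReal.tsum_mul_left, expNeg_add, expNeg_nat_mul, gridProb]
  congr 1
  split_ifs with h
  · rw [ENNReal.tsum_eq_zero.2, expNeg_zero]
    intro j
    by_cases hj : y j ∈ sector M i
    · rw [indicator_of_mem hj, if_neg]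
      refine not_lt.2 (h.trans ?_)
      by_cases hjk : j = k i
      · rw [hjk]
      · have := ((hk i).2 j hj hjk).le
        gcongr
    · exact indicator_of_notMem hj _
  · rw [ENNReal.tsum_eq_top_of_eq_top ⟨k i, ?_⟩, expNeg_top]
    rw [indicator_of_mem (hk i).1, if_pos (not_le.1 h)]

/-- The signed sum over `p.2.2` is the difference of two such indicators and selects the cell of the
nearest point; the sum over `p.1` is the binomial expansion. -/
lemma sum_cellLoss (hc : 0 < c) (hk : IsNearest M y k) (n m : ℕ) (i : Fin M) :
    ∑ p ∈ cellIndex n m, cellCoeff n p * expNeg (∑' j, cellLoss Γ α c M m i p (y j)) =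
      if c * ‖y (k i)‖ ^ 2 < m then
        (1 - gridProb Γ α c M m i ⌊c * ‖y (k i)‖ ^ 2 * 2 ^ m⌋₊ y) ^ n else 0 := by
  simp_rw [expNeg_tsum_cellLoss hc hk]
  rw [sum_cellIndex (by positivity) n m fun k l ↦ gridProb Γ α c M m i l y ^ k]
  simp_rw [one_sub_pow_eq_sum]

lemma abs_sum_cellLoss_le (hc : 0 < c) (hk : IsNearest M y k) (n m : ℕ) (i : Fin M) :
    |∑ p ∈ cellIndex n m, cellCoeff n p * expNeg (∑' j, cellLoss Γ α c M m i p (y j))| ≤ 1 := by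
  rw [sum_cellLoss hc hk]
  split_ifs
  · have h0 : 0 ≤ gridProb Γ α c M m i ⌊c * ‖y (k i)‖ ^ 2 * 2 ^ m⌋₊ y := expNeg_nonneg _
    have h1 : gridProb Γ α c M m i ⌊c * ‖y (k i)‖ ^ 2 * 2 ^ m⌋₊ y ≤ 1 := expNeg_le_one _
    rw [abs_of_nonneg (pow_nonneg (by linarith) n)]
    exact pow_le_one₀ (by linarith) (by linarith)
  · simp

lemma tendsto_sum_cellLoss (hΓ : 0 < Γ) (hα : 0 < α) (hc : 0 < c) (hk : IsNearest M y k) (n : ℕ)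
    (i : Fin M) :
    Tendsto (fun m ↦ ∑ p ∈ cellIndex n m, cellCoeff n p *
      expNeg (∑' j, cellLoss Γ α c M m i p (y j))) atTop
      (𝓝 ((1 - expNeg (∑' j, outerLoss Γ α c M i (c * ‖y (k i)‖ ^ 2) (y j))) ^ n)) := by
  set t := c * ‖y (k i)‖ ^ 2 with ht
  have ht0 : 0 ≤ t := by positivity
  have h : Tendsto (fun m ↦ (1 - gridProb Γ α c M m i ⌊t * 2 ^ m⌋₊ y) ^ n) atTop
      (𝓝 ((1 - expNeg (∑' j, outerLoss Γ α c M i t (y j))) ^ n)) := by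
    refine (tendsto_const_nhds.sub ((continuous_expNeg.tendsto _).comp ?_)).pow n
    refine tendsto_tsum_of_monotone (fun j m m' hm ↦ ?_) fun j ↦ ?_
    · exact indicator_le_indicator (monotone_gridLoss hΓ hα ht0 (by positivity) hm)
    · by_cases hj : y j ∈ sector M i
      · simp only [indicator_of_mem hj, outerLoss]
        have := tendsto_gridLoss (s := c * ‖y j‖ ^ 2) hΓ hα ht0
        by_cases hs : t < c * ‖y j‖ ^ 2
        · rw [if_pos hs] at this
          rwa [indicator_of_mem (show y j ∈ sector M i ∩ {z | t < c * ‖z‖ ^ 2} from ⟨hj, hs⟩)]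
        · rw [if_neg hs] at this
          rwa [indicator_of_notMem fun h ↦ hs h.2]
      · simp only [indicator_of_notMem hj, outerLoss]
        rw [indicator_of_notMem fun h ↦ hj h.1]
        exact tendsto_const_nhds
  refine h.congr' ?_
  obtain ⟨N, hN⟩ := exists_nat_gt t
  filter_upwards [eventually_ge_atTop N] with m hm
  rw [sum_cellLoss hc hk, if_pos]
  exact hN.trans_le (by exact_mod_cast hm)

end Config

/-! ### Expectations of the discretized sums -/

section Expectation

lemma expMeasure_Ici {t : ℝ} (ht : 0 ≤ t) : (expMeasure 1).real (Ici t) = Real.exp (-t) := by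
  have hac : expMeasure 1 ≪ volume := withDensity_absolutelyContinuous _ _
  have e : {x | ENNReal.ofReal t < ENNReal.ofReal x} = Ioi t := by
    ext x
    rw [mem_ofPred_eq, ENNReal.ofReal_lt_ofReal_iff_of_nonneg ht, mem_Ioi]
  have h := expMeasure_lt_ofReal (ENNReal.ofReal t)
  rw [e] at h
  rw [measureReal_congr (hac.ae_eq Ioi_ae_eq_Ici).symm, measureReal_def, h,
    ENNReal.toReal_ofReal (expNeg_nonneg _), expNeg_ofReal ht]

lemma ae_pos_expMeasure : ∀ᵐ x ∂expMeasure 1, 0 < x := by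
  have h := expMeasure_lt_ofReal 0
  rw [expNeg_zero, ENNReal.ofReal_one] at h
  have e : {x | 0 < ENNReal.ofReal x} = Ioi 0 := by ext x; simp
  rw [e] at h
  exact (mem_ae_iff_prob_eq_one measurableSet_Ioi).2 h

/-- The exponent of the expected attenuation, for a serving base station in cell `l`. -/
noncomputable def gridIntegral (Γ α : ℝ) (m k l : ℕ) : ℝ≥0∞ :=
  ∫⁻ s in Ioi (0 : ℝ), ENNReal.ofReal (1 - expNeg (k * gridLoss Γ α m l s))

lemma tendsto_gridIntegral {Γ α t : ℝ} (hΓ : 0 < Γ) (hα : 0 < α) (ht : 0 < t) (k : ℕ) :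
    Tendsto (fun m ↦ gridIntegral Γ α m k ⌊t * 2 ^ m⌋₊) atTop
      (𝓝 (ENNReal.ofReal t * (2 * tailIntegral Γ α k))) := by
  have e : ENNReal.ofReal t * (2 * tailIntegral Γ α k) = ∫⁻ s in Ioi (0 : ℝ),
      ENNReal.ofReal (1 - expNeg (k * if t < s then logLoss Γ α t s else 0)) := by
    rw [← setLIntegral_logLoss hΓ ht k, ← lintegral_indicator measurableSet_Ioi,
      ← lintegral_indicator measurableSet_Ioi]
    refine lintegral_congr fun s ↦ ?_
    by_cases h : t < s
    · rw [indicator_of_mem (mem_Ioi.2 h), indicator_of_mem (mem_Ioi.2 (ht.trans h)), if_pos h]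
    · rw [indicator_of_notMem (by simpa using h)]
      simp [indicator, h]
  rw [e]
  refine lintegral_tendsto_of_tendsto_of_monotone (fun m ↦ Measurable.aemeasurable (by fun_prop))
    ?_ ?_
  · filter_upwards [ae_restrict_mem measurableSet_Ioi] with s hs m m' hm
    refine ENNReal.ofReal_le_ofReal (sub_le_sub_left (expNeg_antitone ?_) _)
    exact mul_le_mul_right (monotone_gridLoss hΓ hα ht.le (mem_Ioi.1 hs).le hm) _
  · refine Eventually.of_forall fun s ↦ ?_
    refine (ENNReal.continuous_ofReal.tendsto _).comp
      (tendsto_const_nhds.sub ((continuous_expNeg.tendsto _).comp ?_))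
    exact ENNReal.Tendsto.const_mul (tendsto_gridLoss hΓ hα ht.le) (Or.inr (by simp))

lemma integral_expNeg_tailIntegral {Γ α : ℝ} (k : ℕ) :
    ∫ t, expNeg (ENNReal.ofReal t * (2 * tailIntegral Γ α k)) ∂expMeasure 1 = moment Γ α k := by
  by_cases h : tailIntegral Γ α k = ∞
  · rw [moment, h]
    simp only [ENNReal.mul_top two_ne_zero, add_top, ENNReal.div_top, ENNReal.toReal_zero]
    refine integral_eq_zero_of_ae ?_
    filter_upwards [ae_pos_expMeasure] with t ht
    -- Here `t > 0` matters, since `0 * ∞ = 0` would give the value `1`.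
    rw [ENNReal.mul_top (by simpa using ht)]
    simp
  · have h2 : 2 * tailIntegral Γ α k = ENNReal.ofReal (2 * tailIntegral Γ α k).toReal :=
      (ENNReal.ofReal_toReal (ENNReal.mul_ne_top (by simp) h)).symm
    rw [moment, h2]
    set a := (2 * tailIntegral Γ α k).toReal with ha
    have ha0 : 0 ≤ a := ENNReal.toReal_nonneg
    simp_rw [mul_comm _ (ENNReal.ofReal a)]
    rw [integral_expNeg_mul_expMeasure ha0, expNeg_ofReal_log (by linarith), ENNReal.toReal_div,
      ENNReal.toReal_add (by simp) (by simp), ENNReal.toReal_ofReal ha0]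
    simp

/-- The factor `exp (-a)` is the probability that an auxiliary exponential variable is at least `a`.
The sum is thus the mean of a step function of that variable, and dominated convergence applies with
bound `∑ₖ (n choose k)`. -/
lemma tendsto_integral_dyadic {Γ α : ℝ} (hΓ : 0 < Γ) (hα : 0 < α) (n : ℕ) :
    Tendsto (fun m : ℕ ↦ ∑ p ∈ cellIndex n m, cellCoeff n p *
      (Real.exp (-(((p.2.1 : ℝ) + p.2.2) / 2 ^ m)) * expNeg (gridIntegral Γ α m p.1 p.2.1))) atTop
      (𝓝 (coeffA Γ α n)) := by
  have e : ∀ m : ℕ, ∑ p ∈ cellIndex n m, cellCoeff n p *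
      (Real.exp (-(((p.2.1 : ℝ) + p.2.2) / 2 ^ m)) * expNeg (gridIntegral Γ α m p.1 p.2.1)) =
      ∫ t, (if t < m then ∑ k ∈ Finset.range (n + 1), (-1) ^ k * (n.choose k : ℝ) *
        expNeg (gridIntegral Γ α m k ⌊t * 2 ^ m⌋₊) else 0) ∂expMeasure 1 := by
    intro m
    have h1 : ∫ t, (if t < m then ∑ k ∈ Finset.range (n + 1), (-1) ^ k * (n.choose k : ℝ) *
        expNeg (gridIntegral Γ α m k ⌊t * 2 ^ m⌋₊) else 0) ∂expMeasure 1 =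
        ∫ t, ∑ p ∈ cellIndex n m, cellCoeff n p *
          ((Ici (((p.2.1 : ℝ) + p.2.2) / 2 ^ m)).indicator 1 t *
            expNeg (gridIntegral Γ α m p.1 p.2.1)) ∂expMeasure 1 := by
      refine integral_congr_ae ?_
      filter_upwards [ae_pos_expMeasure] with t ht
      exact (sum_cellIndex ht.le n m fun k l ↦ expNeg (gridIntegral Γ α m k l)).symm
    rw [h1, integral_finsetSum]
    · refine Finset.sum_congr rfl fun p _ ↦ ?_
      rw [integral_const_mul, integral_mul_const, integral_indicator_one measurableSet_Ici,
        expMeasure_Ici (by positivity)]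
    · intro p _
      exact (((integrable_const (1 : ℝ)).indicator measurableSet_Ici).mul_const _).const_mul _
  have lim : coeffA Γ α n = ∫ t, ∑ k ∈ Finset.range (n + 1), (-1) ^ k * (n.choose k : ℝ) *
      expNeg (ENNReal.ofReal t * (2 * tailIntegral Γ α k)) ∂expMeasure 1 := by
    rw [integral_finsetSum]
    · refine Finset.sum_congr rfl fun k _ ↦ ?_
      rw [integral_const_mul, integral_expNeg_tailIntegral, moment]
    · intro k _
      exact ((integrable_const (1 : ℝ)).mono' (Measurable.aestronglyMeasurable (by fun_prop))
        (Eventually.of_forall fun t ↦ norm_expNeg_le _)).const_mul _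
  simp_rw [e]
  rw [lim]
  refine tendsto_integral_of_dominated_convergence
    (fun _ ↦ ∑ k ∈ Finset.range (n + 1), (n.choose k : ℝ)) (fun m ↦ ?_) (integrable_const _)
    (fun m ↦ Eventually.of_forall fun t ↦ ?_) ?_
  · refine Measurable.aestronglyMeasurable (Measurable.ite measurableSet_Iio ?_ measurable_const)
    refine Finset.measurable_sum _ fun k _ ↦ Measurable.const_mul ?_ _
    exact (measurable_from_top (f := fun l ↦ expNeg (gridIntegral Γ α m k l))).comp
      (Nat.measurable_floor.comp (by fun_prop))
  · split_ifs
    · refine (norm_sum_le _ _).trans (Finset.sum_le_sum fun k _ ↦ ?_)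
      rw [norm_mul, norm_mul, norm_pow, norm_neg, norm_one, one_pow, one_mul, Real.norm_natCast]
      exact mul_le_of_le_one_right (by positivity) (norm_expNeg_le _)
    · rw [norm_zero]
      positivity
  · filter_upwards [ae_pos_expMeasure] with t ht
    have h : Tendsto (fun m : ℕ ↦ ∑ k ∈ Finset.range (n + 1), (-1) ^ k * (n.choose k : ℝ) *
        expNeg (gridIntegral Γ α m k ⌊t * 2 ^ m⌋₊)) atTop
        (𝓝 (∑ k ∈ Finset.range (n + 1), (-1) ^ k * (n.choose k : ℝ) *
          expNeg (ENNReal.ofReal t * (2 * tailIntegral Γ α k)))) :=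
      tendsto_finsetSum _ fun k _ ↦ tendsto_const_nhds.mul
        ((continuous_expNeg.tendsto _).comp (tendsto_gridIntegral hΓ hα ht k))
    refine h.congr' ?_
    obtain ⟨N, hN⟩ := exists_nat_gt t
    filter_upwards [eventually_ge_atTop N] with m hm
    rw [if_pos (hN.trans_le (by exact_mod_cast hm))]

variable {Ω : Type*} [MeasurableSpace Ω] {μ : Measure Ω} [IsProbabilityMeasure μ] {lam : ℝ≥0}
  {x : ℕ → Ω → ℂ}

lemma IsPoissonPointProcess.integrable_expNeg (hx : IsPoissonPointProcess μ lam x)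
    {h : ℂ → ℝ≥0∞} (hh : Measurable h) : Integrable (fun ω ↦ expNeg (∑' j, h (x j ω))) μ :=
  (integrable_const (1 : ℝ)).mono' (measurable_expNeg.comp (Measurable.tsum fun j ↦
    hh.comp (hx.measurable j))).aestronglyMeasurable
    (Eventually.of_forall fun _ ↦ norm_expNeg_le _)

/-- Independence of the sectors, read off from the Laplace functional: for functions with disjoint
supports, `1 - exp (-∑ hᵢ) = ∑ (1 - exp (-hᵢ))`. -/
lemma IsPoissonPointProcess.integral_prod_expNeg (hx : IsPoissonPointProcess μ lam x) {M : ℕ}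
    {h : Fin M → ℂ → ℝ≥0∞} (hh : ∀ i, Measurable (h i))
    (hs : ∀ i z, z ∉ sector M i → h i z = 0) :
    ∫ ω, ∏ i, expNeg (∑' j, h i (x j ω)) ∂μ = ∏ i, ∫ ω, expNeg (∑' j, h i (x j ω)) ∂μ := by
  have e : ∀ z, ENNReal.ofReal (1 - expNeg (∑ i, h i z)) =
      ∑ i, ENNReal.ofReal (1 - expNeg (h i z)) := by
    intro z
    by_cases hz : ∃ i, z ∈ sector M i
    · obtain ⟨i, hi⟩ := hz
      have h0 : ∀ j, j ≠ i → h j z = 0 := fun j hj ↦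
        hs j z fun hzj ↦ Set.disjoint_left.1 (disjoint_sector hj) hzj hi
      rw [Finset.sum_eq_single i (fun j _ hj ↦ h0 j hj) (by simp),
        Finset.sum_eq_single i (fun j _ hj ↦ by simp [h0 j hj]) (by simp)]
    · push Not at hz
      simp [fun i ↦ hs i z (hz i)]
  have e2 : ∀ ω, ∏ i, expNeg (∑' j, h i (x j ω)) = expNeg (∑' j, ∑ i, h i (x j ω)) := by
    intro ω
    rw [← expNeg_sum, Summable.tsum_finsetSum fun _ _ ↦ ENNReal.summable]
  simp_rw [e2]
  rw [hx.integral_expNeg_tsum (h := fun z ↦ ∑ i, h i z)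
    (Finset.measurable_sum _ fun i _ ↦ hh i)]
  simp_rw [e, fun i ↦ hx.integral_expNeg_tsum (hh i)]
  rw [lintegral_finsetSum _ fun i _ ↦ by have := hh i; fun_prop, Finset.mul_sum, expNeg_sum]

lemma IsPoissonPointProcess.integral_prod_sum (hx : IsPoissonPointProcess μ lam x) {M : ℕ}
    {ι : Type*} (T : Finset ι) (a : ι → ℝ) {h : Fin M → ι → ℂ → ℝ≥0∞}
    (hh : ∀ i p, Measurable (h i p)) (hs : ∀ i p z, z ∉ sector M i → h i p z = 0) :
    ∫ ω, ∏ i, ∑ p ∈ T, a p * expNeg (∑' j, h i p (x j ω)) ∂μ =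
      ∏ i, ∑ p ∈ T, a p * ∫ ω, expNeg (∑' j, h i p (x j ω)) ∂μ := by
  classical
  simp_rw [Finset.prod_univ_sum, Finset.prod_mul_distrib]
  rw [integral_finsetSum]
  · refine Finset.sum_congr rfl fun q _ ↦ ?_
    rw [integral_const_mul, hx.integral_prod_expNeg (fun i ↦ hh i (q i)) fun i ↦ hs i (q i)]
  · intro q _
    refine Integrable.const_mul ?_ _
    have e2 : ∀ ω, ∏ i, expNeg (∑' j, h i (q i) (x j ω)) =
        expNeg (∑' j, ∑ i, h i (q i) (x j ω)) := by
      intro ω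
      rw [← expNeg_sum, Summable.tsum_finsetSum fun _ _ ↦ ENNReal.summable]
    simp_rw [e2]
    exact hx.integrable_expNeg (h := fun z ↦ ∑ i, h i (q i) z)
      (Finset.measurable_sum _ fun i _ ↦ hh i (q i))

lemma IsPoissonPointProcess.integral_expNeg_cellLoss (hx : IsPoissonPointProcess μ lam x)
    (hlam : 0 < lam) {Γ α : ℝ} {M : ℕ} (m : ℕ) (i : Fin M) {p : ℕ × ℕ × ℕ} (hp : p.2.2 ≤ 1) :
    ∫ ω, expNeg (∑' j, cellLoss Γ α (lam * Real.pi / M) M m i p (x j ω)) ∂μ =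
      Real.exp (-(((p.2.1 : ℝ) + p.2.2) / 2 ^ m)) * expNeg (gridIntegral Γ α m p.1 p.2.1) := by
  have hM : (0 : ℝ) < M := by exact_mod_cast i.pos
  have hl : (0 : ℝ) < lam := hlam
  have hπ := Real.pi_pos
  set c := lam * Real.pi / M with hc
  have hc0 : 0 < c := by positivity
  set a := ((p.2.1 : ℝ) + p.2.2) / 2 ^ m with ha
  have ha0 : 0 ≤ a := by positivity
  have ha1 : a ≤ ((p.2.1 : ℝ) + 1) / 2 ^ m := by
    rw [ha]
    have : (p.2.2 : ℝ) ≤ 1 := by exact_mod_cast hp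
    gcongr
  let g : ℝ → ℝ≥0∞ := fun s ↦
    (Iio a).indicator 1 s + ENNReal.ofReal (1 - expNeg (p.1 * gridLoss Γ α m p.2.1 s))
  have gm : Measurable g := (measurable_const.indicator measurableSet_Iio).add (by fun_prop)
  have e : ∀ z, ENNReal.ofReal (1 - expNeg (cellLoss Γ α c M m i p z)) =
      (sector M i).indicator (fun z ↦ g (c * ‖z‖ ^ 2)) z := by
    intro z
    by_cases hz : z ∈ sector M i
    · rw [cellLoss, indicator_of_mem hz, indicator_of_mem hz]
      simp only [g]
      -- The void part and the loss live on disjoint ranges: `gridLoss` vanishes below the upper end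
      -- of the cell, and `a` does not exceed that end because `p.2.2 ≤ 1`.
      by_cases hs : c * ‖z‖ ^ 2 < a
      · rw [if_pos hs, indicator_of_mem (mem_Iio.2 hs), gridLoss, if_neg (not_le.2 (hs.trans_le ha1))]
        simp
      · rw [if_neg hs, indicator_of_notMem (by simpa using hs), zero_add, zero_add]
    · simp [cellLoss, hz]
  -- The choice `c = λπ / M` normalizes the rate of `c ‖z‖²` within a sector to one; here `λ` and
  -- `M` disappear.
  have e2 : (lam : ℝ≥0∞) * ENNReal.ofReal (Real.pi / (M * c)) = 1 := by
    rw [← ENNReal.ofReal_coe_nnreal, ← ENNReal.ofReal_mul hl.le, ← ENNReal.ofReal_one]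
    congr 1
    rw [hc]
    field_simp
  rw [hx.integral_expNeg_tsum (measurable_cellLoss Γ α c M m i p)]
  simp_rw [e]
  rw [lintegral_indicator (measurableSet_sector M i), setLIntegral_sector i hc0 gm, ← mul_assoc,
    e2, one_mul, lintegral_add_left (measurable_one.indicator measurableSet_Iio),
    lintegral_indicator_one measurableSet_Iio, Measure.restrict_apply measurableSet_Iio,
    inter_comm, Ioi_inter_Iio, Real.volume_Ioo, sub_zero, expNeg_add, expNeg_ofReal ha0]
  rfl

/-- The probability of `n` failures, given the success probabilities for a fixed configuration. -/
theorem IsPoissonPointProcess.integral_prod_pow (hx : IsPoissonPointProcess μ lam x)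
    (hlam : 0 < lam) {Γ α : ℝ} (hΓ : 0 < Γ) (hα : 0 < α) {M : ℕ} (hM : 1 ≤ M) (n : ℕ)
    {q : Ω → ℝ} (hq : ∀ᵐ ω ∂μ, ∀ k, IsNearest M (fun j ↦ x j ω) k →
      q ω = ∏ i, (1 - expNeg (∑' j, outerLoss Γ α (lam * Real.pi / M) M i
        (lam * Real.pi / M * ‖x (k i) ω‖ ^ 2) (x j ω)))) :
    ∫ ω, q ω ^ n ∂μ = coeffA Γ α n ^ M := by
  have hM' : (0 : ℝ) < M := by exact_mod_cast hM
  have hl : (0 : ℝ) < lam := hlam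
  have hπ := Real.pi_pos
  set c := lam * Real.pi / M with hc
  have hc0 : 0 < c := by positivity
  have step : ∀ m, ∫ ω, ∏ i : Fin M, ∑ p ∈ cellIndex n m, cellCoeff n p *
      expNeg (∑' j, cellLoss Γ α c M m i p (x j ω)) ∂μ =
      (∑ p ∈ cellIndex n m, cellCoeff n p *
      (Real.exp (-(((p.2.1 : ℝ) + p.2.2) / 2 ^ m)) * expNeg (gridIntegral Γ α m p.1 p.2.1))) ^ M := by
    intro m
    rw [hx.integral_prod_sum (cellIndex n m) (cellCoeff n)
      (fun i p ↦ measurable_cellLoss Γ α c M m i p)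
      fun i p z hz ↦ by rw [cellLoss, indicator_of_notMem hz]]
    rw [← Fin.prod_const]
    refine Finset.prod_congr rfl fun i _ ↦ Finset.sum_congr rfl fun p hp ↦ ?_
    rw [hx.integral_expNeg_cellLoss hlam]
    simp only [cellIndex, Finset.mem_product, Finset.mem_range] at hp
    omega
  refine tendsto_nhds_unique (Tendsto.congr step ?_) ((tendsto_integral_dyadic hΓ hα n).pow M)
  refine tendsto_integral_of_dominated_convergence (fun _ ↦ 1) (fun m ↦ ?_) (integrable_const _)
    (fun m ↦ ?_) ?_
  · refine Finset.aestronglyMeasurable_fun_prod _ fun i _ ↦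
      Finset.aestronglyMeasurable_fun_sum _ fun p _ ↦ ?_
    exact ((hx.integrable_expNeg (measurable_cellLoss Γ α c M m i p)).const_mul _).aestronglyMeasurable
  · filter_upwards [hx.ae_goodConfig hlam M] with ω hω
    obtain ⟨k, hk⟩ := hω.exists_isNearest
    rw [norm_prod]
    exact Finset.prod_le_one (fun _ _ ↦ norm_nonneg _)
      fun i _ ↦ abs_sum_cellLoss_le hc0 hk n m i
  · filter_upwards [hx.ae_goodConfig hlam M, hq] with ω hω hqω
    obtain ⟨k, hk⟩ := hω.exists_isNearest
    rw [hqω k hk, ← Finset.prod_pow]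
    exact tendsto_finsetProd _ fun i _ ↦ tendsto_sum_cellLoss hΓ hα hc0 hk n i

end Expectation

/-! ### Measurability of the success event -/

lemma measurable_pathLoss (C α : ℝ) : Measurable (pathLoss C α) := by
  unfold pathLoss; fun_prop

section Measurability

variable {l : ℝ → ℝ} (W P Γ : ℝ) (M : ℕ)

lemma measurable_sinr (hl : Measurable l) (i : Fin M) (k : ℕ) :
    Measurable fun p : (ℕ → ℂ) × (ℕ → ℝ) ↦ sinr l W P M i p.1 p.2 k := by
  have hr : ∀ j, Measurable fun p : (ℕ → ℂ) × (ℕ → ℝ) ↦ rxPower l (p.1 j) (p.2 j) := by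
    intro j
    unfold rxPower
    fun_prop
  have hi : Measurable fun p : (ℕ → ℂ) × (ℕ → ℝ) ↦ interference l M i p.1 p.2 k := by
    have e : ∀ p : (ℕ → ℂ) × (ℕ → ℝ), interference l M i p.1 p.2 k =
        ∑' j, {q : (ℕ → ℂ) × (ℕ → ℝ) | q.1 j ∈ sector M i ∧ j ≠ k}.indicator
          (fun q ↦ rxPower l (q.1 j) (q.2 j)) p := fun p ↦
      tsum_subtype {j | p.1 j ∈ sector M i ∧ j ≠ k} fun j ↦ rxPower l (p.1 j) (p.2 j)
    simp_rw [e]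
    refine Measurable.tsum fun j ↦ (hr j).indicator ?_
    have : Measurable fun p : (ℕ → ℂ) × (ℕ → ℝ) ↦ p.1 j := by fun_prop
    exact (this (measurableSet_sector M i)).inter (MeasurableSet.const _)
  unfold sinr
  exact (hr k).div (hi.add_const _)

lemma measurableSet_success (hl : Measurable l) :
    MeasurableSet {p : (ℕ → ℂ) × (ℕ → ℝ) | Success l W P Γ M p.1 p.2} := by
  have hc : ∀ j, Measurable fun p : (ℕ → ℂ) × (ℕ → ℝ) ↦ p.1 j := fun j ↦ by fun_prop
  have hs : ∀ (i : Fin M) j, MeasurableSet {p : (ℕ → ℂ) × (ℕ → ℝ) | p.1 j ∈ sector M i} :=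
    fun i j ↦ hc j (measurableSet_sector M i)
  simp only [Success, SectorDetected, ofPred_exists, ofPred_and, ofPred_forall]
  refine MeasurableSet.iUnion fun i ↦ MeasurableSet.iUnion fun k ↦
    (hs i k).inter (MeasurableSet.inter (MeasurableSet.iInter fun j ↦ ?_) ?_)
  · exact (hs i j).imp (measurableSet_le (hl.comp (hc k).norm) (hl.comp (hc j).norm))
  · exact measurableSet_lt measurable_const (measurable_sinr W P M hl i k)

end Measurability

/-! ### The mean number of cycles -/

lemma toENNReal_eq_tsum (a : ℕ∞) : (a : ℝ≥0∞) = ∑' n : ℕ, if (n : ℕ∞) < a then 1 else 0 := by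
  induction a using ENat.recTopCoe with
  | top => simp
  | coe N =>
    rw [tsum_eq_sum (s := Finset.range N)]
    · rw [Finset.sum_congr rfl fun n hn ↦ if_pos (by exact_mod_cast Finset.mem_range.1 hn)]
      simp
    · intro n hn
      rw [if_neg]
      simpa using hn

/-- Cycles are numbered from `1`, so `m < n` stands for cycle `m + 1`, and the fading of index `0`
is never used. -/
lemma lt_numCycles_iff {Ω : Type*} {x : ℕ → Ω → ℂ} {F : ℕ → ℕ → Ω → ℝ} {l : ℝ → ℝ} {W P Γ : ℝ}
    {M : ℕ} (n : ℕ) (ω : Ω) :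
    (n : ℕ∞) < numCycles l W P Γ M x F ω ↔
      ∀ m ∈ Finset.range n, ¬ Success l W P Γ M (fun j ↦ x j ω) fun j ↦ F (m + 1) j ω := by
  rw [numCycles, ← ENat.add_one_le_iff (ENat.natCast_ne_top n)]
  simp only [le_iInf_iff, mem_ofPred_eq, Finset.mem_range]
  constructor
  · intro h m hm hs
    have := h (m + 1) ⟨by omega, hs⟩
    have : n + 1 ≤ m + 1 := by exact_mod_cast this
    omega
  · rintro h m ⟨hm, hs⟩
    obtain ⟨d, rfl⟩ := Nat.exists_eq_add_of_le' hm
    by_contra hc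
    refine h d ?_ hs
    by_contra hd
    exact hc (by exact_mod_cast (by omega : n + 1 ≤ d + 1))

section Network

variable {Ω : Type*} [MeasurableSpace Ω] {μ : Measure Ω} {lam : ℝ≥0} {x : ℕ → Ω → ℂ}
  {F : ℕ → ℕ → Ω → ℝ} {l : ℝ → ℝ} {W P Γ : ℝ} {M : ℕ}

namespace IsPoissonRayleighNetwork

lemma measurable_row (h : IsPoissonRayleighNetwork μ lam x F) (m : ℕ) :
    Measurable fun ω (j : ℕ) ↦ F m j ω :=
  measurable_pi_iff.2 fun j ↦ h.measurable_fading m j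

lemma iIndepFun_row (h : IsPoissonRayleighNetwork μ lam x F) :
    iIndepFun (fun m ω (j : ℕ) ↦ F m j ω) μ :=
  iIndepFun_curry_sigma (κ := fun _ ↦ ℕ) h.measurable_fading
    (h.indep_fading.precomp (Equiv.sigmaEquivProd ℕ ℕ).injective)

lemma iIndepFun_fading (h : IsPoissonRayleighNetwork μ lam x F) (m : ℕ) : iIndepFun (F m) μ :=
  h.indep_fading.precomp (g := fun j ↦ (m, j)) fun _ _ hij ↦ (Prod.mk.inj hij).2

lemma map_row (h : IsPoissonRayleighNetwork μ lam x F) (m : ℕ) :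
    μ.map (fun ω (j : ℕ) ↦ F m j ω) = Measure.infinitePi fun _ ↦ expMeasure 1 := by
  rw [(h.iIndepFun_fading m).map_fun_eq_infinitePi_map (h.measurable_fading m)]
  simp_rw [h.law_fading]

/-- For a fixed configuration, the failures in different cycles are independent and have the same
probability. -/
lemma measure_forall_not_success (h : IsPoissonRayleighNetwork μ lam x F) (hl : Measurable l)
    (y : ℕ → ℂ) (n : ℕ) :
    μ {ω | ∀ m ∈ Finset.range n, ¬ Success l W P Γ M y fun j ↦ F (m + 1) j ω} =
      μ {ω | ¬ Success l W P Γ M y fun j ↦ F 1 j ω} ^ n := by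
  have hS : MeasurableSet {f : ℕ → ℝ | ¬ Success l W P Γ M y f} :=
    (measurable_prodMk_left (measurableSet_success W P Γ M hl)).compl
  have e : {ω | ∀ m ∈ Finset.range n, ¬ Success l W P Γ M y fun j ↦ F (m + 1) j ω} =
      ⋂ m ∈ Finset.range n, (fun ω (j : ℕ) ↦ F (m + 1) j ω) ⁻¹'
        {f : ℕ → ℝ | ¬ Success l W P Γ M y f} := by
    ext ω
    simp
  rw [e, (h.iIndepFun_row.precomp Nat.succ_injective).meas_biInter fun m _ ↦ ⟨_, hS, rfl⟩]
  have e2 : ∀ m, μ ((fun ω (j : ℕ) ↦ F m j ω) ⁻¹' {f : ℕ → ℝ | ¬ Success l W P Γ M y f}) =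
      (Measure.infinitePi fun _ : ℕ ↦ expMeasure 1) {f : ℕ → ℝ | ¬ Success l W P Γ M y f} :=
    fun m ↦ by rw [← h.map_row m, Measure.map_apply (h.measurable_row m) hS]
  rw [Finset.prod_congr rfl fun m _ ↦ e2 (m + 1), Finset.prod_const, Finset.card_range, ← e2 1]
  rfl

/-- The probability of failure in the cycles up to `n`, by conditioning on the locations. -/
lemma measure_lt_numCycles [IsProbabilityMeasure μ] (h : IsPoissonRayleighNetwork μ lam x F)
    (hl : Measurable l) (n : ℕ) :
    MeasurableSet {ω | (n : ℕ∞) < numCycles l W P Γ M x F ω} ∧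
    μ {ω | (n : ℕ∞) < numCycles l W P Γ M x F ω} = ENNReal.ofReal
      (∫ ω, μ.real {ω' | ¬ Success l W P Γ M (fun j ↦ x j ω) fun j ↦ F 1 j ω'} ^ n ∂μ) := by
  have hX : Measurable fun ω (j : ℕ) ↦ x j ω := measurable_pi_iff.2 h.ppp.measurable
  have hF : Measurable fun ω (p : ℕ × ℕ) ↦ F p.1 p.2 ω :=
    measurable_pi_iff.2 fun p ↦ h.measurable_fading p.1 p.2
  have hS := measurableSet_success W P Γ M hl
  let A : ℕ → Set ((ℕ → ℂ) × (ℕ × ℕ → ℝ)) := fun n ↦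
    {p | ∀ m ∈ Finset.range n, ¬ Success l W P Γ M p.1 fun j ↦ p.2 (m + 1, j)}
  have hA : ∀ n, MeasurableSet (A n) := by
    intro n
    have e : A n = ⋂ m ∈ Finset.range n, (fun p : (ℕ → ℂ) × (ℕ × ℕ → ℝ) ↦
        ((p.1, fun j ↦ p.2 (m + 1, j)) : (ℕ → ℂ) × (ℕ → ℝ))) ⁻¹'
        {p | Success l W P Γ M p.1 p.2}ᶜ := by
      ext p
      simp [A]
    rw [e]
    exact Finset.measurableSet_biInter _ fun m _ ↦
      (measurable_fst.prodMk (measurable_pi_iff.2 fun j ↦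
        (measurable_pi_apply _).comp measurable_snd)) hS.compl
  have e1 : {ω | (n : ℕ∞) < numCycles l W P Γ M x F ω} =
      (fun ω ↦ ((fun j ↦ x j ω), fun p : ℕ × ℕ ↦ F p.1 p.2 ω)) ⁻¹' A n := by
    ext ω
    exact lt_numCycles_iff n ω
  have hslice : ∀ n y, μ.map (fun ω (p : ℕ × ℕ) ↦ F p.1 p.2 ω) (Prod.mk y ⁻¹' A n) =
      μ {ω | ¬ Success l W P Γ M y fun j ↦ F 1 j ω} ^ n := by
    intro n y
    rw [Measure.map_apply hF (measurable_prodMk_left (hA n)), ← h.measure_forall_not_success hl]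
    rfl
  -- Measurability of the one-cycle failure probability is the case `n = 1` of the measurability of
  -- slices.
  have hq : Measurable fun ω ↦ μ {ω' | ¬ Success l W P Γ M (fun j ↦ x j ω) fun j ↦ F 1 j ω'} := by
    have := (measurable_measure_prodMk_left
      (ν := μ.map (fun ω (p : ℕ × ℕ) ↦ F p.1 p.2 ω)) (hA 1)).comp hX
    simpa only [Function.comp_def, hslice, pow_one] using this
  refine ⟨e1 ▸ (hX.prodMk hF) (hA n), ?_⟩
  have hp := (indepFun_iff_map_prod_eq_prod_map_map hX.aemeasurable hF.aemeasurable).1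
    h.indep_locations
  have : IsProbabilityMeasure (μ.map fun ω (p : ℕ × ℕ) ↦ F p.1 p.2 ω) :=
    Measure.isProbabilityMeasure_map hF.aemeasurable
  rw [e1, ← Measure.map_apply (hX.prodMk hF) (hA n), hp, Measure.prod_apply (hA n),
    lintegral_map (measurable_measure_prodMk_left (hA n)) hX]
  simp_rw [hslice]
  simp_rw [measureReal_def]
  rw [integral_eq_lintegral_of_nonneg_ae (Eventually.of_forall fun ω ↦ by positivity)
    (hq.ennreal_toReal.pow_const n).aestronglyMeasurable, ENNReal.ofReal_toReal]
  · refine lintegral_congr fun ω ↦ ?_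
    rw [ENNReal.ofReal_pow ENNReal.toReal_nonneg, ENNReal.ofReal_toReal (measure_ne_top _ _)]
  · refine ((lintegral_mono fun ω ↦ ?_).trans_lt (by simp : ∫⁻ _, 1 ∂μ < ∞)).ne
    exact ENNReal.ofReal_le_one.2 (pow_le_one₀ measureReal_nonneg measureReal_le_one)

theorem meanCycles_eq [IsProbabilityMeasure μ] (h : IsPoissonRayleighNetwork μ lam x F)
    (hlam : 0 < lam) (hM : 1 ≤ M) {α C : ℝ} (hΓ : 0 < Γ) (hα : 0 < α) (hC : 0 < C) :
    meanCycles μ (pathLoss C α) 0 P Γ M x F =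
      ∑' j : ℕ, ENNReal.ofReal (coeffA Γ α j) ^ M := by
  have hl := measurable_pathLoss C α
  have hM' : (0 : ℝ) < M := by exact_mod_cast hM
  have hlam' : (0 : ℝ) < lam := hlam
  have hπ := Real.pi_pos
  rw [meanCycles]
  simp_rw [toENNReal_eq_tsum]
  rw [lintegral_tsum]
  · refine tsum_congr fun n ↦ ?_
    obtain ⟨hm, hμ⟩ := h.measure_lt_numCycles (W := 0) (P := P) (Γ := Γ) (M := M) hl n
    have e : ∀ ω, (if (n : ℕ∞) < numCycles (pathLoss C α) 0 P Γ M x F ω then 1 else 0 : ℝ≥0∞) =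
        {ω | (n : ℕ∞) < numCycles (pathLoss C α) 0 P Γ M x F ω}.indicator 1 ω := fun ω ↦ by
      simp [indicator]
    simp_rw [e]
    rw [lintegral_indicator_one hm, hμ, h.ppp.integral_prod_pow hlam hΓ hα hM n,
      ENNReal.ofReal_pow (coeffA_nonneg hΓ n)]
    filter_upwards [h.ppp.ae_goodConfig hlam M] with ω hω k hk
    exact measure_not_success (h.measurable_fading 1) (h.law_fading 1) (h.iIndepFun_fading 1)
      hΓ hα hC (by positivity) hω hk
  · intro n
    exact (Measurable.ite (h.measure_lt_numCycles hl n).1 measurable_const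
      measurable_const).aemeasurable

end IsPoissonRayleighNetwork

end Network

end CellSearch

/-! ### The main theorem -/

theorem mainTheorem8 (M : ℕ) (hM : 1 ≤ M) (Γ α : ℝ) (hΓ : 0 < Γ) (hα : 0 < α) :
    (∀ j : ℕ, 0 ≤ CellSearch.coeffA Γ α j) ∧
    (∀ (Ω : Type*) [MeasurableSpace Ω] (μ : Measure Ω) [IsProbabilityMeasure μ]
      (lam : ℝ≥0) (_ : 0 < lam) (C P : ℝ) (_ : 0 < C) (_ : 0 < P)
      (x : ℕ → Ω → ℂ) (F : ℕ → ℕ → Ω → ℝ)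
      (_ : CellSearch.IsPoissonRayleighNetwork μ lam x F),
      CellSearch.meanCycles μ (CellSearch.pathLoss C α) 0 P Γ M x F =
        ∑' j : ℕ, ENNReal.ofReal (CellSearch.coeffA Γ α j) ^ M) ∧
    (∀ (Ω₁ : Type*) (Ω₂ : Type*) [MeasurableSpace Ω₁] [MeasurableSpace Ω₂]
      (μ₁ : Measure Ω₁) (μ₂ : Measure Ω₂) [IsProbabilityMeasure μ₁] [IsProbabilityMeasure μ₂]
      (lam₁ lam₂ : ℝ≥0) (_ : 0 < lam₁) (_ : 0 < lam₂) (C P : ℝ) (_ : 0 < C) (_ : 0 < P)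
      (x₁ : ℕ → Ω₁ → ℂ) (F₁ : ℕ → ℕ → Ω₁ → ℝ) (x₂ : ℕ → Ω₂ → ℂ) (F₂ : ℕ → ℕ → Ω₂ → ℝ)
      (_ : CellSearch.IsPoissonRayleighNetwork μ₁ lam₁ x₁ F₁)
      (_ : CellSearch.IsPoissonRayleighNetwork μ₂ lam₂ x₂ F₂),
      CellSearch.meanCycles μ₁ (CellSearch.pathLoss C α) 0 P Γ M x₁ F₁ =
        CellSearch.meanCycles μ₂ (CellSearch.pathLoss C α) 0 P Γ M x₂ F₂) := by
  refine ⟨CellSearch.coeffA_nonneg hΓ, ?_, ?_⟩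
  · intro Ω _ μ _ lam hlam C P hC _ x F h
    exact h.meanCycles_eq hlam hM hΓ hα hC
  · intro Ω₁ Ω₂ _ _ μ₁ μ₂ _ _ lam₁ lam₂ hlam₁ hlam₂ C P hC _ x₁ F₁ x₂ F₂ h₁ h₂
    rw [h₁.meanCycles_eq hlam₁ hM hΓ hα hC, h₂.meanCycles_eq hlam₂ hM hΓ hα hC]
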